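/- **Setting.** Let $\mathcal X\subset\mathbb R^m$ be a finite set of $n$ points, $d$ the Euclidean distance, and $\mathcal C=\{C_1,\dots,C_k\}$, $k\ge 1$, a partition of $\mathcal X$ into nonempty clusters with means $\mu_i=\frac1{|C_i|}\sum_{x\in C_i}x$. Assume that $\mathcal C$ is center-based (for $x\in\mathcal X$: $x\in C_i$ if and only if $i=\arg\min_j d(x,\mu_j)$) and has the $\gamma$-margin property, $\gamma>1$: $\gamma\, d(x,\mu_i)<d(y,\mu_i)$ for all $i$, $x\in C_i$, $y\in\mathcal X\setminus C_i$. Let $q\in(0,1]$ and $\delta\in(0,1)$. **Oracle.** A query $Q(x,y)$ is answered by $1$ (same cluster), $-1$ (different clusters) or $0$ (not sure). The oracle is $q$ random-weak: each query, independently of everything else, is answered by $0$ with a probability at most $1-q$, which may depend on the clusters of $x$ and $y$ but not on the positions of the two points inside their clusters, and is answered correctly otherwise. **Cluster assignment.** The algorithm keeps a list of known points, one from each cluster met so far, which is empty at the start and kept over all rounds. The index of a point $x$ is sought by querying $x$ against all $k'\le k$ known points: a yes gives the index of that known point; if $k'<k$ and all answers are no, $x$ becomes the known point with index $k'+1$;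 if $k'=k$ and exactly $k-1$ answers are no and one is not sure, $x$ gets the remaining index; otherwise its index is not known. **Algorithm (SSAC with Random-Weak BinarySearch), with parameters $\eta\in\mathbb R$, $\beta\in\mathbb N$.** Start with $S_1=\mathcal X$. For $i=1,\dots,k$: 1. Fail if $S_i$ is empty. Draw $\lceil k\eta\rceil$ points independently and uniformly from $S_i$ and ask for their cluster indices. Let $Z_t$ be the list of drawn points found to have index $t$, let $p$ maximize $|Z_t|$ (the smallest such $t$), and let $\mu'$ be the mean of $Z_p$. Fail if $Z_p$ is empty. 2. Sort $S_i$ by increasing distance to $\mu'$ and find by binary search the first point $x_{j^*}$ that is not in the cluster of $Z_p$. A search step at $x_j$ draws $\beta$ points from $Z_p$ (by any rule, with or without replacement) and queries each of them against $x_j$; the search goes to the right of $x_j$ if there is an answer $1$, to the left if there is an answer $-1$, and the algorithm fails if all $\beta$ answers are not sure. Put $r'=d(x_{j^*},\mu')$, or $r'=\infty$ if no such point exists; output the cluster $C'=\{x\in S_i: d(x,\mu')<r'\}$ and put $S_{i+1}=S_i\setminus C'$. The output is the set of the $k$ clusters $C'$. **Theorem.** If $$\eta\ \ge\ \frac{\log\frac{2k(m+1)}{\delta}}{\log\frac{1}{1-q^{k-1}+q^{k-1}e^{-(\gamma-1)^2/8}}},\qquad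 \beta\ \ge\ \frac{\log\frac{2k(\lfloor\log_2 n\rfloor+1)}{\delta}}{\log\frac1{1-q}},\qquad \beta\ge 1,$$ (for $q=1$ the second bound is read as its limit $0$), then with probability at least $1-\delta$ the algorithm does not fail and its output is $\mathcal C$. -/

import Mathlib

/-! ### Center-based clusterings with the margin property -/

/-- The arithmetic mean of a finite set of points. -/
noncomputable def clusterMean {m : ℕ} (A : Finset (EuclideanSpace ℝ (Fin m))) :
    EuclideanSpace ℝ (Fin m) :=
  (A.card : ℝ)⁻¹ • ∑ x ∈ A, x

/-- `C` is a partition of `X` into `k` nonempty clusters, and a point of `X` is in the `i`-th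
cluster exactly if the `i`-th center (the mean of that cluster) is a nearest one. Since the clusters
are disjoint, the nearest center is then unique. -/
structure IsCenterBased {m k : ℕ} (X : Finset (EuclideanSpace ℝ (Fin m)))
    (C : Fin k → Finset (EuclideanSpace ℝ (Fin m))) : Prop where
  nonempty : ∀ i, (C i).Nonempty
  disjoint : ∀ i j, i ≠ j → Disjoint (C i) (C j)
  cover : ∀ x, x ∈ X ↔ ∃ i, x ∈ C i
  nearest : ∀ x ∈ X, ∀ i,
    (x ∈ C i ↔ ∀ j, dist x (clusterMean (C i)) ≤ dist x (clusterMean (C j)))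

/-- The `γ`-margin property, with the means of the clusters as centers. -/
def HasMargin {m k : ℕ} (γ : ℝ) (X : Finset (EuclideanSpace ℝ (Fin m)))
    (C : Fin k → Finset (EuclideanSpace ℝ (Fin m))) : Prop :=
  ∀ i, ∀ x ∈ C i, ∀ y ∈ X, y ∉ C i →
    γ * dist x (clusterMean (C i)) < dist y (clusterMean (C i))

/-! ### Random-weak oracles

An oracle is a map that sends a pair of points to the law of its answer: `1` (same cluster),
`-1` (different clusters) or `0` (not sure). In a randomized algorithm each query is a fresh draw
from that law, independent of everything drawn before. -/

/-- A `q` random-weak oracle for the clustering `C`: its answers are never wrong, it is not sure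
with probability at most `1 - q`, and whether it is not sure does not depend on the positions of the
two points inside their clusters. -/
structure IsRandomWeakOracle {m k : ℕ} (q : ℝ)
    (C : Fin k → Finset (EuclideanSpace ℝ (Fin m)))
    (Q : EuclideanSpace ℝ (Fin m) → EuclideanSpace ℝ (Fin m) → PMF SignType) : Prop where
  same : ∀ i, ∀ x ∈ C i, ∀ y ∈ C i, Q x y (-1) = 0
  different : ∀ i j, i ≠ j → ∀ x ∈ C i, ∀ y ∈ C j, Q x y 1 = 0
  notSure_le : ∀ i j, ∀ x ∈ C i, ∀ y ∈ C j, Q x y 0 ≤ ENNReal.ofReal (1 - q)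
  notSure_eq : ∀ i j, ∀ x ∈ C i, ∀ x' ∈ C i, ∀ y ∈ C j, ∀ y' ∈ C j, Q x y 0 = Q x' y' 0

/-! ### The algorithm -/

section Algorithm

variable {E : Type}

/-- `r` independent draws from `p`. -/
noncomputable def drawIID (p : PMF E) : ℕ → PMF (List E)
  | 0 => pure []
  | r + 1 => do
    let x ← p
    let xs ← drawIID p r
    pure (x :: xs)

/-- What follows about the cluster index of a point from the answers `as` to the queries of the point
against one known point from each of the `as.length ≤ k` clusters that were met so far: a yes gives
the index; if fewer than `k` clusters were met and all answers are no, the point opens a new cluster;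
if all `k` clusters were met and all answers but one are no, it is in the remaining one. Otherwise
the index is not known. -/
def inferIndex (k : ℕ) (as : List SignType) : Option ℕ :=
  if 1 ∈ as then some (as.idxOf 1)
  else if as.length < k ∧ 0 ∉ as then some as.length
  else if as.length = k ∧ as.count 0 = 1 then some (as.idxOf 0)
  else none

/-- Cluster-assignment queries for a list of points, one after the other. `reps` lists a known point
of each cluster met so far. The result is the new list of known points, and the list of those points
whose cluster index was found, with their indices. -/
noncomputable def assignAll (k : ℕ) (Q : E → E → PMF SignType) :
    List E → List E → PMF (List E × List (E × ℕ))
  | [], reps => pure (reps, [])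
  | x :: xs, reps => do
    let as ← reps.mapM (fun y => Q x y)
    match inferIndex k as with
    | none => assignAll k Q xs reps
    | some t => do
      let res ← assignAll k Q xs (if t < reps.length then reps else reps ++ [x])
      pure (res.1, (x, t) :: res.2)

/-- The points with index `t`, listed with multiplicity. -/
def pointsWithIndex (Z : List (E × ℕ)) (t : ℕ) : List E :=
  (Z.filter (fun a => a.2 = t)).map Prod.fst

/-- One step of the search, at the point `x`: draw the points `B` by which `x` is tested, and query
each of them against `x`. The result is `1` or `-1` if some answer says so, and `0` if all the answers
are not sure. -/
noncomputable def searchStep (Q : E → E → PMF SignType) (drawB : PMF (List E)) (x : E) :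
    PMF SignType := do
  let B ← drawB
  let as ← B.mapM (fun y => Q y x)
  pure (if 1 ∈ as then 1 else if -1 ∈ as then -1 else 0)

/-- Binary search in the list `L`, between the positions `lo` (included) and `hi` (excluded), for the
first position whose point does not pass `test`; `none` if some test is not sure. -/
noncomputable def binarySearch (test : E → PMF SignType) (L : List E) (lo hi : ℕ) :
    PMF (Option ℕ) :=
  if _h : lo < hi then
    match L[(lo + hi - 1) / 2]? with
    | none => pure none
    | some x => (test x).bind fun a =>
      match a with
      | .pos => binarySearch test L ((lo + hi - 1) / 2 + 1) hi
      | .neg => binarySearch test L lo ((lo + hi - 1) / 2)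
      | .zero => pure none
  else pure (some lo)
termination_by hi - lo
decreasing_by all_goals omega

end Algorithm

open Classical in
/-- The points of `S` in increasing order of their distance to `c`. -/
noncomputable def sortByDist {m : ℕ} (c : EuclideanSpace ℝ (Fin m))
    (S : Finset (EuclideanSpace ℝ (Fin m))) : List (EuclideanSpace ℝ (Fin m)) :=
  S.toList.insertionSort (fun x y => dist x c ≤ dist y c)

open Classical in
/-- The points of `S` that are closer to `c` than the point at position `j` in the list `L`; all of
`S` if the list has no such position, that is, if the radius is infinite. -/
noncomputable def cutAt {m : ℕ} (c : EuclideanSpace ℝ (Fin m))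
    (S : Finset (EuclideanSpace ℝ (Fin m))) (L : List (EuclideanSpace ℝ (Fin m))) (j : ℕ) :
    Finset (EuclideanSpace ℝ (Fin m)) :=
  match L[j]? with
  | some y => S.filter (fun x => dist x c < dist y c)
  | none => S

/-- One round, on the remaining points `S`. Phase 1: draw `r` points uniformly and independently from
`S`, find their cluster indices as far as possible, select the index with the most points, and take
the mean of these points. Phase 2: binary search for the radius of the cluster, where the points for
the tests are drawn by `draw` from the points with the selected index. The result is the cluster found
and the new list of known points, or `none` if the round fails. -/
noncomputable def ssacRound {m : ℕ} (k r : ℕ)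
    (Q : EuclideanSpace ℝ (Fin m) → EuclideanSpace ℝ (Fin m) → PMF SignType)
    (draw : List (EuclideanSpace ℝ (Fin m)) → PMF (List (EuclideanSpace ℝ (Fin m))))
    (S : Finset (EuclideanSpace ℝ (Fin m))) (reps : List (EuclideanSpace ℝ (Fin m))) :
    PMF (Option (Finset (EuclideanSpace ℝ (Fin m)) × List (EuclideanSpace ℝ (Fin m)))) :=
  open Classical in
  if hS : S.Nonempty then do
    let xs ← drawIID (PMF.uniformOfFinset S hS) r
    let res ← assignAll k Q xs reps
    match (List.range k).argmax (fun t => (pointsWithIndex res.2 t).length) with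
    | none => pure none
    | some p =>
      let Zp := pointsWithIndex res.2 p
      if Zp = [] then pure none
      else do
        let c := (Zp.length : ℝ)⁻¹ • Zp.sum
        let L := sortByDist c S
        let j ← binarySearch (searchStep Q (draw Zp)) L 0 L.length
        pure (j.map (fun j => (cutAt c S L j, res.1)))
  else pure none

open Classical in
/-- `n` rounds, on the remaining points `S`, where `found` is the set of clusters found before. -/
noncomputable def ssacLoop {m : ℕ} (k r : ℕ)
    (Q : EuclideanSpace ℝ (Fin m) → EuclideanSpace ℝ (Fin m) → PMF SignType)
    (draw : List (EuclideanSpace ℝ (Fin m)) → PMF (List (EuclideanSpace ℝ (Fin m)))) :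
    ℕ → Finset (EuclideanSpace ℝ (Fin m)) → List (EuclideanSpace ℝ (Fin m)) →
      Finset (Finset (EuclideanSpace ℝ (Fin m))) →
      PMF (Option (Finset (Finset (EuclideanSpace ℝ (Fin m)))))
  | 0, _, _, found => pure (some found)
  | n + 1, S, reps, found => do
    let res ← ssacRound k r Q draw S reps
    match res with
    | none => pure none
    | some (A, reps') => ssacLoop k r Q draw n (S \ A) reps' (insert A found)

/-- The law of the output of the algorithm: `k` rounds, each with `⌈k η⌉` samples; `none` stands for
failure. -/
noncomputable def ssac {m : ℕ} (k : ℕ) (η : ℝ)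
    (Q : EuclideanSpace ℝ (Fin m) → EuclideanSpace ℝ (Fin m) → PMF SignType)
    (draw : List (EuclideanSpace ℝ (Fin m)) → PMF (List (EuclideanSpace ℝ (Fin m))))
    (X : Finset (EuclideanSpace ℝ (Fin m))) :
    PMF (Option (Finset (Finset (EuclideanSpace ℝ (Fin m))))) :=
  ssacLoop k ⌈(k : ℝ) * η⌉₊ Q draw k X [] ∅

/-- A rule that draws `β` points from a given nonempty list of points, with or without
replacement. -/
def IsDrawRule {E : Type} (β : ℕ) (draw : List E → PMF (List E)) : Prop :=
  ∀ Z, Z ≠ [] → ∀ B ∈ (draw Z).support, B.length = β ∧ ∀ y ∈ B, y ∈ Z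

open Classical in
/-- The set of the clusters of an indexed clustering. -/
noncomputable def clusterSet {m k : ℕ} (C : Fin k → Finset (EuclideanSpace ℝ (Fin m))) :
    Finset (Finset (EuclideanSpace ℝ (Fin m))) :=
  Finset.univ.image C

/-! ### The lower bounds on the sampling parameters -/

/-- The lower bound on the sample size `η`. -/
noncomputable def etaBound (m k : ℕ) (q γ δ : ℝ) : ℝ :=
  Real.log (2 * k * (m + 1) / δ) /
    Real.log (1 / (1 - q ^ (k - 1) + q ^ (k - 1) * Real.exp (-(γ - 1) ^ 2 / 8)))

/-- The lower bound on the number `β` of queries in a step of the search; `⌊log₂ n⌋ + 1` is the number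
of steps of a binary search among `n ≥ 1` points in the worst case. At `q = 1` the bound is the
limit for `q → 1`. -/
noncomputable def betaBound (n k : ℕ) (q δ : ℝ) : ℝ :=
  if q = 1 then 0
  else Real.log (2 * k * ((Nat.log 2 n : ℝ) + 1) / δ) / Real.log (1 / (1 - q))

/-! Each of the k rounds may fail with probability δ/k, half of it for the sample and half for the
search; the errors are added by `PMF.expect_bind_le_add`.

Suppose the mean of the selected sample points is within (γ-1)/2 · R of the center of their cluster,
where R is the radius of the cluster. By the margin and the triangle inequality every point of the
cluster is then closer to the sample mean than any other point (`HasMargin.dist_lt`), so the cluster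
is an initial segment of the sorted list. Since answers are never wrong, the search can only fail at
a step with β unsure answers, which has probability at most (1-q)^β, and there are at most ⌊log₂ n⌋
+ 1 steps.

For the sample, both the number of found points and the selected cluster are random. The law of an
answer depends on the labels (the clusters of the points) only, hence so does the law of the found
indices (`indexAll_map`): given labels and indices, the sampled points of a cluster are still
independent and uniform in it. Convexity of s ↦ cosh √s yields a Hoeffding bound without dependence
on the dimension (`cosh_norm_add_le`, `expect_assignAll_cosh_le`): with l = (γ-1)/(2R) and c =
(γ-1)²/8, the mean of n found points is bad with conditional probability at most 2e^{-cn}. The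
selected cluster has at least as many found points as any other, in particular as one with N ≥ η
sample points. Each of those is found with probability at least q^{k-1} whatever happened before, so
e^{-cn} has expectation at most ρ^N, where ρ = 1 - q^{k-1} + q^{k-1}e^{-c}
(`expect_exp_labelCount_le`). The event that a given cluster is selected depends on labels and
indices only and serves as a weight, so the choice of the cluster costs no factor k. The factor 2 is
at most m+1 unless m = 0, where there are no deviations at all. -/

open scoped ENNReal

/-! ### Expectations with respect to a `PMF` -/

section Expect

variable {α β : Type}

/-- The expectation of a nonnegative function. -/
noncomputable def PMF.expect (p : PMF α) (f : α → ℝ≥0∞) : ℝ≥0∞ := ∑' a, p a * f a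

namespace PMF

theorem expect_pure (a : α) (f : α → ℝ≥0∞) : (PMF.pure a).expect f = f a := by
  rw [expect, tsum_eq_single a]
  · simp
  · intro b hb
    simp [PMF.pure_apply, hb]

theorem expect_bind (p : PMF α) (g : α → PMF β) (f : β → ℝ≥0∞) :
    (p.bind g).expect f = p.expect fun a => (g a).expect f := by
  simp only [expect, PMF.bind_apply, ← ENNReal.tsum_mul_right, ← ENNReal.tsum_mul_left]
  rw [ENNReal.tsum_comm]
  simp only [mul_assoc]

theorem expect_mono {p : PMF α} {f g : α → ℝ≥0∞} (h : ∀ a ∈ p.support, f a ≤ g a) :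
    p.expect f ≤ p.expect g := by
  refine ENNReal.tsum_le_tsum fun a => ?_
  by_cases ha : p a = 0
  · simp [ha]
  · gcongr
    exact h a ((p.mem_support_iff a).2 ha)

theorem expect_congr {p : PMF α} {f g : α → ℝ≥0∞} (h : ∀ a ∈ p.support, f a = g a) :
    p.expect f = p.expect g :=
  le_antisymm (expect_mono fun a ha => (h a ha).le) (expect_mono fun a ha => (h a ha).ge)

theorem expect_const (p : PMF α) (c : ℝ≥0∞) : p.expect (fun _ => c) = c := by
  simp [expect, ENNReal.tsum_mul_right, p.tsum_coe]

theorem expect_le {p : PMF α} {f : α → ℝ≥0∞} {c : ℝ≥0∞} (h : ∀ a ∈ p.support, f a ≤ c) :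
    p.expect f ≤ c :=
  (expect_mono h).trans (expect_const p c).le

theorem expect_add (p : PMF α) (f g : α → ℝ≥0∞) :
    p.expect (fun a => f a + g a) = p.expect f + p.expect g := by
  simp [expect, mul_add, ENNReal.tsum_add]

theorem expect_const_mul (p : PMF α) (c : ℝ≥0∞) (f : α → ℝ≥0∞) :
    p.expect (fun a => c * f a) = c * p.expect f := by
  simp [expect, ← ENNReal.tsum_mul_left, mul_left_comm]

theorem expect_mul_const (p : PMF α) (c : ℝ≥0∞) (f : α → ℝ≥0∞) :
    p.expect (fun a => f a * c) = p.expect f * c := by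
  simp [expect, ← ENNReal.tsum_mul_right, mul_assoc]

theorem expect_tsum {ι : Type} (p : PMF α) (f : ι → α → ℝ≥0∞) :
    p.expect (fun a => ∑' i, f i a) = ∑' i, p.expect (f i) := by
  simp only [expect, ← ENNReal.tsum_mul_left]
  rw [ENNReal.tsum_comm]

theorem expect_finset_sum {ι : Type} (s : Finset ι) (p : PMF α) (f : ι → α → ℝ≥0∞) :
    p.expect (fun a => ∑ i ∈ s, f i a) = ∑ i ∈ s, p.expect (f i) := by
  simp only [expect, Finset.mul_sum]
  exact Summable.tsum_finsetSum fun _ _ => ENNReal.summable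

theorem expect_indicator_compl_add (p : PMF α) (P : Set α) :
    p.expect (Pᶜ.indicator 1) + p.expect (P.indicator 1) = 1 := by
  rw [← expect_add, ← expect_const p 1]
  refine expect_congr fun a _ => ?_
  by_cases h : a ∈ P <;> simp [h]

theorem expect_indicator_singleton (p : PMF α) (a : α) :
    p.expect (({a} : Set α).indicator 1) = p a := by
  rw [expect, tsum_eq_single a]
  · simp
  · intro b hb
    simp [hb]

/-- The union bound for two consecutive random choices. -/
theorem expect_bind_le_add {p : PMF α} {g : α → PMF β} {f : β → ℝ≥0∞} {P : Set α} {a b : ℝ≥0∞}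
    (hf : ∀ y, f y ≤ 1) (hp : p.expect (Pᶜ.indicator 1) ≤ a)
    (hg : ∀ x ∈ p.support, x ∈ P → (g x).expect f ≤ b) :
    (p.bind g).expect f ≤ a + b := by
  rw [expect_bind]
  calc p.expect (fun x => (g x).expect f)
      ≤ p.expect (fun x => Pᶜ.indicator 1 x + b) := by
        refine expect_mono fun x hx => ?_
        by_cases h : x ∈ P
        · simpa [h] using hg x hx h
        · simpa [h] using (expect_le fun y _ => hf y).trans (le_self_add (a := 1) (b := b))
    _ ≤ a + b := by
        rw [expect_add, expect_const]
        gcongr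

theorem expect_uniformOfFinset (S : Finset α) (hS : S.Nonempty) (f : α → ℝ≥0∞) :
    (PMF.uniformOfFinset S hS).expect f = (S.card : ℝ≥0∞)⁻¹ * ∑ x ∈ S, f x := by
  classical
  rw [expect, tsum_eq_sum (s := S), Finset.mul_sum]
  · exact Finset.sum_congr rfl fun x hx => by simp [hx]
  · intro b hb
    simp [hb]

end PMF

end Expect

/-! ### A Hoeffding bound for random vectors -/

section Hoeffding

/-- The power series ∑ sⁿ/(2n)! has nonnegative coefficients, and each sⁿ is convex on [0, ∞). This
makes squared norms, which are affine in an inner product, usable as arguments of `cosh`. -/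
theorem cosh_sqrt_convexOn : ConvexOn ℝ (Set.Ici 0) fun s : ℝ => Real.cosh (Real.sqrt s) := by
  have key : ∀ s : ℝ, 0 ≤ s →
      HasSum (fun n : ℕ => s ^ n / ((2 * n).factorial : ℝ)) (Real.cosh (Real.sqrt s)) := by
    intro s hs
    have := Real.hasSum_cosh (Real.sqrt s)
    simpa [pow_mul, Real.sq_sqrt hs] using this
  refine ⟨convex_Ici 0, ?_⟩
  intro x hx y hy a b ha hb hab
  have hx' : 0 ≤ x := hx
  have hy' : 0 ≤ y := hy
  have hxy : 0 ≤ a • x + b • y := by simp only [smul_eq_mul]; positivity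
  refine hasSum_le (fun n => ?_) (key _ hxy) (((key x hx').mul_left a).add ((key y hy').mul_left b))
  have := (convexOn_pow n).2 hx hy ha hb hab
  simp only [smul_eq_mul] at this ⊢
  calc (a * x + b * y) ^ n / ((2 * n).factorial : ℝ)
      ≤ (a * x ^ n + b * y ^ n) / ((2 * n).factorial : ℝ) := by gcongr
    _ = _ := by ring

/-- `cosh` of a norm, after a bounded step, lies below an affine function of the step. -/
theorem cosh_norm_add_le {F : Type*} [NormedAddCommGroup F] [InnerProductSpace ℝ F]
    {l R : ℝ} (hR : 0 ≤ R) (v d : F) (hd : ‖d‖ ≤ R) :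
    Real.cosh (l * ‖v + d‖) ≤ Real.cosh (l * ‖v‖) * Real.cosh (l * R) +
      (inner ℝ v d / (‖v‖ * R)) * (Real.sinh (l * ‖v‖) * Real.sinh (l * R)) := by
  have hcosh : ∀ x : ℝ, Real.cosh (Real.sqrt (x ^ 2)) = Real.cosh x := by
    intro x
    rw [Real.sqrt_sq_eq_abs, Real.cosh_abs]
  have hle : ‖v + d‖ ^ 2 ≤ ‖v‖ ^ 2 + R ^ 2 + 2 * inner ℝ v d := by
    rw [norm_add_sq_real]
    have : ‖d‖ ^ 2 ≤ R ^ 2 := by gcongr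
    linarith
  have hin : |inner ℝ v d| ≤ ‖v‖ * R := (abs_real_inner_le_norm v d).trans (by gcongr)
  -- If ‖v‖R = 0, the quotient in the statement is 0 by convention, and one of v and d vanishes.
  rcases (mul_nonneg (norm_nonneg v) hR).eq_or_lt with h0 | hpos
  · have hz : inner ℝ v d = (0 : ℝ) := by
      rw [← h0] at hin
      exact abs_nonpos_iff.1 hin
    rw [hz, zero_div, zero_mul, add_zero]
    rcases mul_eq_zero.1 h0.symm with h | h
    · rw [norm_eq_zero] at h
      subst h
      simp only [zero_add, norm_zero, mul_zero, Real.cosh_zero, one_mul]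
      rw [Real.cosh_le_cosh, abs_mul, abs_mul, abs_of_nonneg (norm_nonneg d), abs_of_nonneg hR]
      gcongr
    · subst h
      have : d = 0 := norm_le_zero_iff.1 hd
      simp [this]
  · set θ : ℝ := inner ℝ v d / (‖v‖ * R) with hθ
    have hin' : inner ℝ v d = θ * (‖v‖ * R) := by rw [hθ, div_mul_cancel₀ _ hpos.ne']
    have hθ1 : |θ| ≤ 1 := by
      rw [hθ, abs_div, abs_of_pos hpos]
      exact div_le_one_of_le₀ hin hpos.le
    obtain ⟨h1, h2⟩ := abs_le.1 hθ1
    -- The upper bound for ‖v + d‖² is the convex combination, with weights (1 ± θ)/2, of the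
    -- extreme values (‖v‖ ± R)². The addition formulas for `cosh` then separate the constant part
    -- from the part linear in θ.
    have hconv := cosh_sqrt_convexOn.2 (Set.mem_Ici.2 (sq_nonneg (l * (‖v‖ + R))))
      (Set.mem_Ici.2 (sq_nonneg (l * (‖v‖ - R)))) (show 0 ≤ (1 + θ) / 2 by linarith)
      (show 0 ≤ (1 - θ) / 2 by linarith) (by ring)
    simp only [smul_eq_mul, hcosh] at hconv
    have harg : (1 + θ) / 2 * (l * (‖v‖ + R)) ^ 2 + (1 - θ) / 2 * (l * (‖v‖ - R)) ^ 2 =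
        l ^ 2 * (‖v‖ ^ 2 + R ^ 2 + 2 * inner ℝ v d) := by
      rw [hin']
      ring
    rw [harg] at hconv
    calc Real.cosh (l * ‖v + d‖)
        = Real.cosh (Real.sqrt (l ^ 2 * ‖v + d‖ ^ 2)) := by rw [← mul_pow, hcosh]
      _ ≤ Real.cosh (Real.sqrt (l ^ 2 * (‖v‖ ^ 2 + R ^ 2 + 2 * inner ℝ v d))) := by
          rw [Real.cosh_le_cosh, abs_of_nonneg (Real.sqrt_nonneg _),
            abs_of_nonneg (Real.sqrt_nonneg _)]
          gcongr
      _ ≤ _ := hconv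
      _ = _ := by
          rw [mul_add, mul_sub, Real.cosh_add, Real.cosh_sub]
          ring

/-- The correction terms are linear in the step and cancel over a centered family, so an averaged
step costs only the factor cosh(lR), whatever the dimension. -/
theorem sum_cosh_norm_add_le {F ι : Type*} [NormedAddCommGroup F] [InnerProductSpace ℝ F]
    {l R : ℝ} (hR : 0 ≤ R) (v : F) (A : Finset ι) (d : ι → F) (hd : ∀ i ∈ A, ‖d i‖ ≤ R)
    (h0 : ∑ i ∈ A, d i = 0) :
    ∑ i ∈ A, Real.cosh (l * ‖v + d i‖) ≤
      A.card * (Real.cosh (l * ‖v‖) * Real.cosh (l * R)) := by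
  refine (Finset.sum_le_sum fun i hi => cosh_norm_add_le (l := l) hR v (d i) (hd i hi)).trans ?_
  rw [Finset.sum_add_distrib, ← Finset.sum_mul A fun i => inner ℝ v (d i) / (‖v‖ * R),
    ← Finset.sum_div, ← inner_sum, h0]
  simp

end Hoeffding

/-! ### Oracles whose answers depend on labels -/

section LabelOracle

variable {E : Type}

theorem indicator_one_le_of_imp {α β : Type*} {s : Set α} {t : Set β} {a : α} {b : β}
    (h : a ∈ s → b ∈ t) : s.indicator (1 : α → ℝ≥0∞) a ≤ t.indicator (1 : β → ℝ≥0∞) b := by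
  by_cases ha : a ∈ s
  · simp [ha, h ha]
  · simp [ha]

theorem indicator_one_le_one {α : Type*} (s : Set α) (a : α) :
    s.indicator (1 : α → ℝ≥0∞) a ≤ 1 :=
  Set.indicator_le_self' (by simp) _

theorem PMF.expect_signType (p : PMF SignType) (f : SignType → ℝ≥0∞) :
    p.expect f = p 0 * f 0 + p (-1) * f (-1) + p 1 * f 1 := by
  have : (Finset.univ : Finset SignType) = {0, -1, 1} := by decide
  rw [PMF.expect, tsum_fintype, this, Finset.sum_insert (by decide), Finset.sum_insert (by decide),
    Finset.sum_singleton, add_assoc]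

theorem PMF.signType_sum (p : PMF SignType) : p 0 + p (-1) + p 1 = 1 := by
  simpa [PMF.expect_const] using (p.expect_signType fun _ => 1).symm

theorem mapM_pmf_nil (f : E → PMF SignType) : ([] : List E).mapM f = PMF.pure [] :=
  List.mapM_nil

theorem mapM_pmf_cons (f : E → PMF SignType) (y : E) (ys : List E) :
    (y :: ys).mapM f = (f y).bind fun a => (ys.mapM f).bind fun as => PMF.pure (a :: as) :=
  List.mapM_cons

theorem forall₂_of_mem_support_mapM {f : E → PMF SignType} {ys : List E} {as : List SignType}
    (h : as ∈ (ys.mapM f).support) : List.Forall₂ (fun y a => a ∈ (f y).support) ys as := by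
  induction ys generalizing as with
  | nil =>
    rw [mapM_pmf_nil, PMF.support_pure] at h
    rw [Set.mem_singleton_iff.1 h]
    exact .nil
  | cons y ys ih =>
    rw [mapM_pmf_cons, PMF.mem_support_bind_iff] at h
    obtain ⟨a, ha, h⟩ := h
    rw [PMF.mem_support_bind_iff] at h
    obtain ⟨as', has', h⟩ := h
    rw [PMF.support_pure] at h
    rw [Set.mem_singleton_iff.1 h]
    exact .cons ha (ih has')

/-- Some answer is `1`, except with the probability that one of the queries misses it. -/
theorem expect_mapM_one_notMem_le {f : E → PMF SignType} {ys : List E} {y : E} (hy : y ∈ ys)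
    {c : ℝ≥0∞} (hc : f y 0 + f y (-1) ≤ c) :
    (ys.mapM f).expect ({as | 1 ∉ as}.indicator 1) ≤ c := by
  induction ys with
  | nil => simp at hy
  | cons z ys ih =>
    rw [mapM_pmf_cons]
    simp only [PMF.expect_bind, PMF.expect_pure]
    rcases List.mem_cons.1 hy with rfl | hy
    · calc _ ≤ (f y).expect (fun a => if a = 1 then 0 else 1) := by
            refine PMF.expect_mono fun a _ => PMF.expect_le fun as _ => ?_
            by_cases ha : a = 1
            · simp [ha]
            · rw [if_neg ha]
              exact indicator_one_le_one _ _
        _ ≤ c := by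
            rw [PMF.expect_signType]
            simpa using hc
    · refine PMF.expect_le fun a _ => le_trans (PMF.expect_mono fun as _ => ?_) (ih hy)
      exact indicator_one_le_of_imp fun h => by simp_all

/-- All the answers are sure with the product of the probabilities. -/
theorem le_expect_mapM_zero_notMem {f : E → PMF SignType} {ys : List E} {c : ℝ≥0∞}
    (hc : ∀ y ∈ ys, c ≤ f y (-1) + f y 1) :
    c ^ ys.length ≤ (ys.mapM f).expect ({as | 0 ∉ as}.indicator 1) := by
  induction ys with
  | nil =>
    rw [mapM_pmf_nil, PMF.expect_pure]
    simp
  | cons y ys ih =>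
    rw [mapM_pmf_cons]
    simp only [PMF.expect_bind, PMF.expect_pure]
    have ih' := ih fun z hz => hc z (List.mem_cons_of_mem _ hz)
    have hy := hc y List.mem_cons_self
    calc c ^ (y :: ys).length
        = c ^ ys.length * c := by rw [List.length_cons, pow_succ]
      _ ≤ (ys.mapM f).expect ({as | 0 ∉ as}.indicator 1) * (f y (-1) + f y 1) := by gcongr
      _ = (f y).expect (fun a => if a = 0 then 0 else
            (ys.mapM f).expect ({as | 0 ∉ as}.indicator 1)) := by
          rw [PMF.expect_signType]
          simp only [if_true, mul_zero, zero_add, reduceCtorEq, if_false]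
          ring
      _ ≤ _ := by
          refine PMF.expect_mono fun a _ => ?_
          by_cases ha : a = 0
          · simp [ha]
          · rw [if_neg ha]
            refine PMF.expect_mono fun as _ => indicator_one_le_of_imp fun h => ?_
            have h : (0 : SignType) ∉ as := h
            simp [Ne.symm ha, h]

/-- All the answers are not sure with at most the product of the probabilities. -/
theorem expect_mapM_forall_zero_le {f : E → PMF SignType} {ys : List E} {c : ℝ≥0∞}
    (hc : ∀ y ∈ ys, f y 0 ≤ c) :
    (ys.mapM f).expect ({as | ∀ a ∈ as, a = 0}.indicator 1) ≤ c ^ ys.length := by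
  induction ys with
  | nil =>
    rw [mapM_pmf_nil, PMF.expect_pure]
    simp
  | cons y ys ih =>
    rw [mapM_pmf_cons]
    simp only [PMF.expect_bind, PMF.expect_pure]
    have ih' := ih fun z hz => hc z (List.mem_cons_of_mem _ hz)
    have hy := hc y List.mem_cons_self
    calc _ ≤ (f y).expect (fun a => if a = 0 then
            (ys.mapM f).expect ({as | ∀ a ∈ as, a = 0}.indicator 1) else 0) := by
          refine PMF.expect_mono fun a _ => ?_
          by_cases ha : a = 0
          · rw [if_pos ha]
            refine PMF.expect_mono fun as _ => indicator_one_le_of_imp fun h => ?_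
            intro b hb
            exact h b (List.mem_cons_of_mem _ hb)
          · rw [if_neg ha]
            refine PMF.expect_le fun as _ => ?_
            rw [Set.indicator_of_notMem]
            intro h
            exact ha (h a List.mem_cons_self)
      _ = f y 0 * (ys.mapM f).expect ({as | ∀ a ∈ as, a = 0}.indicator 1) := by
          rw [PMF.expect_signType]
          simp
      _ ≤ c * c ^ ys.length := by gcongr
      _ = _ := by rw [List.length_cons, pow_succ']

/-- The answers of the oracle depend on the labels of the two points, are never wrong, and are not
sure with probability at most `1 - q`. -/
structure IsLabelOracle {k : ℕ} (q : ℝ) (X : Set E) (lab : E → Fin k)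
    (Q : E → E → PMF SignType) : Prop where
  same : ∀ x ∈ X, ∀ y ∈ X, lab x = lab y → Q x y (-1) = 0
  different : ∀ x ∈ X, ∀ y ∈ X, lab x ≠ lab y → Q x y 1 = 0
  notSure_le : ∀ x ∈ X, ∀ y ∈ X, Q x y 0 ≤ ENNReal.ofReal (1 - q)
  congr : ∀ x ∈ X, ∀ x' ∈ X, ∀ y ∈ X, ∀ y' ∈ X, lab x = lab x' → lab y = lab y' →
    Q x y = Q x' y'

/-- A list of points with at most one point from each cluster. -/
structure IsKnownList {k : ℕ} (X : Set E) (lab : E → Fin k) (reps : List E) : Prop where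
  mem : ∀ y ∈ reps, y ∈ X
  nodup : (reps.map lab).Nodup

variable {k : ℕ} {q : ℝ} {X : Set E} {lab : E → Fin k} {Q : E → E → PMF SignType} {reps : List E}

theorem IsKnownList.length_le (h : IsKnownList X lab reps) : reps.length ≤ k := by
  simpa using h.nodup.length_le_card

theorem IsKnownList.length_lt (h : IsKnownList X lab reps) {l : Fin k} (hl : l ∉ reps.map lab) :
    reps.length < k := by
  have := (List.nodup_cons.2 ⟨hl, h.nodup⟩).length_le_card
  simpa using this

theorem inferIndex_isSome_of_one_mem {as : List SignType} (h : 1 ∈ as) :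
    (inferIndex k as).isSome := by
  simp [inferIndex, h]

theorem inferIndex_isSome_of_zero_notMem {as : List SignType} (h : 0 ∉ as) (hk : as.length < k) :
    (inferIndex k as).isSome := by
  unfold inferIndex
  split_ifs <;> simp_all

theorem IsLabelOracle.answers (hQ : IsLabelOracle q X lab Q) {x : E} (hx : x ∈ X)
    (hreps : ∀ y ∈ reps, y ∈ X) {as : List SignType} (has : as ∈ (reps.mapM (Q x)).support) :
    List.Forall₂ (fun l a => (a = 1 → l = lab x) ∧ (a = -1 → l ≠ lab x)) (reps.map lab) as := by
  have h := forall₂_of_mem_support_mapM has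
  rw [List.forall₂_map_left_iff]
  induction h with
  | nil => exact .nil
  | @cons y a ys as' ha hs ih =>
    have hy := hreps y List.mem_cons_self
    rw [PMF.mem_support_iff] at ha
    refine .cons ⟨?_, ?_⟩ (ih (fun z hz => hreps z (List.mem_cons_of_mem _ hz)) ?_)
    · rintro rfl
      by_contra hne
      exact ha (hQ.different x hx y hy (Ne.symm hne))
    · rintro rfl heq
      exact ha (hQ.same x hx y hy heq.symm)
    · rw [mapM_pmf_cons, PMF.mem_support_bind_iff] at has
      obtain ⟨b, -, has⟩ := has
      rw [PMF.mem_support_bind_iff] at has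
      obtain ⟨bs, hbs, has⟩ := has
      rw [PMF.support_pure, Set.mem_singleton_iff, List.cons.injEq] at has
      rwa [has.2]

/-- A yes identifies the label, and a full list of no's excludes all known labels. If k distinct
labels are known, they exhaust `Fin k`, so the only one not excluded is the right one. -/
theorem inferIndex_spec {ls : List (Fin k)} (hnd : ls.Nodup) {l : Fin k} {as : List SignType}
    (h : List.Forall₂ (fun l' a => (a = 1 → l' = l) ∧ (a = -1 → l' ≠ l)) ls as) {t : ℕ}
    (ht : inferIndex k as = some t) :
    ls[t]? = some l ∨ t = ls.length ∧ l ∉ ls := by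
  have hlen := h.length_eq
  rw [List.forall₂_iff_get] at h
  obtain ⟨-, h⟩ := h
  unfold inferIndex at ht
  split_ifs at ht with h1 h2 h3
  · obtain rfl := Option.some.inj ht
    have hlt := List.idxOf_lt_length_iff.2 h1
    left
    rw [List.getElem?_eq_getElem (hlen ▸ hlt)]
    simpa using (h _ (hlen ▸ hlt) hlt).1 (by simp)
  · obtain rfl := Option.some.inj ht
    refine Or.inr ⟨hlen.symm, fun hl => ?_⟩
    obtain ⟨i, hi, rfl⟩ := List.getElem_of_mem hl
    have hi' : i < as.length := hlen ▸ hi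
    rcases SignType.trichotomy as[i] with ha | ha | ha
    · exact (h i hi hi').2 ha rfl
    · exact h2.2 (ha ▸ List.getElem_mem hi')
    · exact h1 (ha ▸ List.getElem_mem hi')
  · obtain rfl := Option.some.inj ht
    left
    have hmem : l ∈ ls := by
      by_contra hl
      have := (List.nodup_cons.2 ⟨hl, hnd⟩).length_le_card
      simp at this
      omega
    obtain ⟨i, hi, hil⟩ := List.getElem_of_mem hmem
    have hi' : i < as.length := hlen ▸ hi
    have h0 : as[i] = 0 := by
      rcases SignType.trichotomy as[i] with ha | ha | ha
      · exact absurd hil ((h i hi hi').2 ha)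
      · exact ha
      · exact absurd (ha ▸ List.getElem_mem hi') h1
    -- The first 0 is at the position of `l`: otherwise there would be two zeros, against the count.
    have : as.idxOf 0 = i := by
      by_contra hne
      have hidx : as.idxOf 0 < as.length :=
        List.idxOf_lt_length_iff.2 (h0 ▸ List.getElem_mem hi')
      have hdup : List.Duplicate 0 as := by
        rw [List.duplicate_iff_exists_distinct_get]
        rcases lt_or_gt_of_ne hne with hlt | hlt
        · exact ⟨⟨_, hidx⟩, ⟨_, hi'⟩, hlt, by simp, by simp [h0]⟩
        · exact ⟨⟨_, hi'⟩, ⟨_, hidx⟩, hlt, by simp [h0], by simp⟩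
      rw [List.duplicate_iff_two_le_count] at hdup
      omega
    rw [this, List.getElem?_eq_getElem hi, hil]

/-- The list of known points after the index of `x` was found to be `t`. -/
theorem IsKnownList.extend (hQ : IsLabelOracle q X lab Q) (hreps : IsKnownList X lab reps)
    {x : E} (hx : x ∈ X) {as : List SignType} (has : as ∈ (reps.mapM (Q x)).support) {t : ℕ}
    (ht : inferIndex k as = some t) :
    IsKnownList X lab (if t < reps.length then reps else reps ++ [x]) ∧
      reps <+: (if t < reps.length then reps else reps ++ [x]) ∧
      ((if t < reps.length then reps else reps ++ [x]).map lab)[t]? = some (lab x) := by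
  rcases inferIndex_spec hreps.nodup (hQ.answers hx hreps.mem has) ht with h | ⟨h, hl⟩
  · have hlt : t < reps.length := by
      by_contra hge
      rw [List.getElem?_eq_none (by simpa using hge)] at h
      cases h
    rw [if_pos hlt]
    exact ⟨hreps, List.prefix_rfl, h⟩
  · rw [List.length_map] at h
    rw [if_neg (by omega)]
    refine ⟨⟨?_, ?_⟩, List.prefix_append _ _, ?_⟩
    · intro y hy
      rcases List.mem_append.1 hy with hy | hy
      · exact hreps.mem y hy
      · rw [List.mem_singleton.1 hy]
        exact hx
    · rw [List.map_append, List.nodup_append]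
      refine ⟨hreps.nodup, by simp, ?_⟩
      rintro a ha b hb rfl
      simp only [List.map_cons, List.map_nil, List.mem_singleton] at hb
      exact hl (hb ▸ ha)
    · subst h
      simp

/-- The index of a point is found with probability at least `q ^ (k - 1)`. -/
theorem expect_inferIndex_none_le (hQ : IsLabelOracle q X lab Q) (hq0 : 0 ≤ q) (hq1 : q ≤ 1)
    (hreps : IsKnownList X lab reps) {x : E} (hx : x ∈ X) :
    (reps.mapM (Q x)).expect ({as | inferIndex k as = none}.indicator 1) ≤
      ENNReal.ofReal (1 - q ^ (k - 1)) := by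
  by_cases hl : lab x ∈ reps.map lab
  · obtain ⟨y, hy, hyx⟩ := List.mem_map.1 hl
    -- For k ≥ 2 one sure answer, from the known point of the same cluster, is enough, and q ≥
    -- q^(k-1). For k = 1 the claimed bound is 0: an unsure answer of the only known point still
    -- leaves its index as the only one possible.
    rcases Nat.lt_or_ge 1 k with hk | hk
    · calc _ ≤ (reps.mapM (Q x)).expect ({as | 1 ∉ as}.indicator 1) := by
            refine PMF.expect_mono fun as _ => indicator_one_le_of_imp fun h h1 => ?_
            have h2 := inferIndex_isSome_of_one_mem (k := k) h1
            rw [show inferIndex k as = none from h] at h2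
            simp at h2
        _ ≤ ENNReal.ofReal (1 - q) := by
            refine expect_mapM_one_notMem_le hy ?_
            rw [hQ.same x hx y (hreps.mem y hy) hyx.symm, add_zero]
            exact hQ.notSure_le x hx y (hreps.mem y hy)
        _ ≤ _ := by
            refine ENNReal.ofReal_le_ofReal ?_
            have := pow_le_of_le_one hq0 hq1 (n := k - 1) (by omega)
            linarith
    · refine PMF.expect_le fun as has => ?_
      suffices h : as ∉ {as | inferIndex k as = none} by simp [h]
      intro h
      have h : inferIndex k as = none := h
      have hlen : as.length = k := by
        have h1 := (hQ.answers hx hreps.mem has).length_eq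
        have h2 := hreps.length_le
        have h3 := List.length_pos_of_mem hy
        rw [List.length_map] at h1
        omega
      have hk1 : k = 1 := by
        have := (lab x).pos
        omega
      have hans := hQ.answers hx hreps.mem has
      obtain ⟨a, rfl⟩ := List.length_eq_one_iff.1 (hlen.trans hk1)
      rcases SignType.trichotomy a with ha | ha | ha
      · subst ha
        rw [List.forall₂_iff_get] at hans
        have hlr : reps.length = 1 := by simpa using hans.1
        refine (hans.2 0 (by simp [hlr]) (by simp)).2 (by simp) ?_
        apply Fin.ext
        omega
      · subst ha hk1
        revert h
        decide
      · subst ha hk1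
        revert h
        decide
  -- The cluster of `x` is new, so at most k-1 points are known, and the index is found as soon as
  -- all their answers are sure.
  · have hlt := hreps.length_lt hl
    have h1 := PMF.expect_indicator_compl_add (reps.mapM (Q x)) {as | 0 ∉ as}
    have h2 : ENNReal.ofReal (q ^ (k - 1)) ≤
        (reps.mapM (Q x)).expect ({as | 0 ∉ as}.indicator 1) := by
      refine le_trans ?_ (le_expect_mapM_zero_notMem (c := ENNReal.ofReal q) fun y hy => ?_)
      · rw [← ENNReal.ofReal_pow hq0]
        exact ENNReal.ofReal_le_ofReal (pow_le_pow_of_le_one hq0 hq1 (by omega))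
      · have h3 := (Q x y).signType_sum
        have h4 := hQ.notSure_le x hx y (hreps.mem y hy)
        have h5 : ENNReal.ofReal (1 - q) + ENNReal.ofReal q = 1 := by
          rw [← ENNReal.ofReal_add (by linarith) hq0]
          simp
        have h6 : ENNReal.ofReal (1 - q) + ENNReal.ofReal q ≤
            ENNReal.ofReal (1 - q) + (Q x y (-1) + Q x y 1) := by
          rw [h5, ← h3, add_assoc]
          gcongr
        exact (ENNReal.add_le_add_iff_left ENNReal.ofReal_ne_top).1 h6
    calc _ ≤ (reps.mapM (Q x)).expect ({as | 0 ∉ as}ᶜ.indicator 1) := by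
          refine PMF.expect_mono fun as has => indicator_one_le_of_imp fun h h0 => ?_
          have hlen := (hQ.answers hx hreps.mem has).length_eq
          rw [List.length_map] at hlen
          have h2 := inferIndex_isSome_of_zero_notMem (k := k) h0 (hlen ▸ hlt)
          rw [show inferIndex k as = none from h] at h2
          simp at h2
      _ ≤ _ := by
          rw [ENNReal.ofReal_sub _ (by positivity), ENNReal.ofReal_one]
          refine ENNReal.le_sub_of_add_le_right ENNReal.ofReal_ne_top ?_
          rw [← h1]
          gcongr

end LabelOracle

/-! ### The law of the cluster assignment -/

section Assignment

variable {E : Type}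

/-- The known points after the index of `x` was found to be `o`. -/
def extendKnown (reps : List E) (x : E) : Option ℕ → List E
  | none => reps
  | some t => if t < reps.length then reps else reps ++ [x]

/-- The law of the list of the indices that cluster assignment finds. -/
noncomputable def indexAll (k : ℕ) (Q : E → E → PMF SignType) :
    List E → List E → PMF (List (Option ℕ))
  | [], _ => PMF.pure []
  | x :: xs, reps => (reps.mapM (Q x)).bind fun as =>
      (indexAll k Q xs (extendKnown reps x (inferIndex k as))).bind fun os =>
        PMF.pure (inferIndex k as :: os)

/-- The points whose index was found, with their indices. -/
def foundPoints : List E → List (Option ℕ) → List (E × ℕ)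
  | x :: xs, some t :: os => (x, t) :: foundPoints xs os
  | _ :: xs, none :: os => foundPoints xs os
  | _, _ => []

theorem assignAll_nil (k : ℕ) (Q : E → E → PMF SignType) (reps : List E) :
    assignAll k Q [] reps = PMF.pure (reps, []) := by
  rw [assignAll]
  rfl

/-- The result for `x :: xs` from the index of `x` and the result for `xs`. -/
def consFound (x : E) : Option ℕ → List E × List (E × ℕ) → List E × List (E × ℕ)
  | none, res => res
  | some t, res => (res.1, (x, t) :: res.2)

theorem assignAll_cons (k : ℕ) (Q : E → E → PMF SignType) (x : E) (xs reps : List E) :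
    assignAll k Q (x :: xs) reps = (reps.mapM (Q x)).bind fun as =>
      (assignAll k Q xs (extendKnown reps x (inferIndex k as))).bind fun res =>
        PMF.pure (consFound x (inferIndex k as) res) := by
  rw [assignAll]
  refine congrArg (PMF.bind (reps.mapM (Q x))) (funext fun as => ?_)
  cases h : inferIndex k as with
  | none => exact (PMF.bind_pure _).symm
  | some t => rfl

/-- All the randomness of the answers sits in the list of indices, of which the found points are a
deterministic function once the sample is given. This lets the index law be factored out before the
positions are averaged. -/
theorem expect_assignAll_snd (k : ℕ) (Q : E → E → PMF SignType) (xs reps : List E)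
    (f : List (E × ℕ) → ℝ≥0∞) :
    (assignAll k Q xs reps).expect (fun res => f res.2) =
      (indexAll k Q xs reps).expect (fun os => f (foundPoints xs os)) := by
  induction xs generalizing reps f with
  | nil => simp only [assignAll_nil, indexAll, PMF.expect_pure, foundPoints]
  | cons x xs ih =>
    simp only [assignAll_cons, indexAll, PMF.expect_bind, PMF.expect_pure]
    congr 1
    funext as
    cases h : inferIndex k as with
    | none => exact ih _ f
    | some t => exact ih _ fun Z => f ((x, t) :: Z)

theorem foundPoints_map {F : Type} (g : E → F) (xs : List E) (os : List (Option ℕ)) :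
    foundPoints (xs.map g) os = (foundPoints xs os).map (Prod.map g id) := by
  induction xs generalizing os with
  | nil => simp [foundPoints]
  | cons x xs ih =>
    match os with
    | [] => simp [foundPoints]
    | none :: os => simpa [foundPoints] using ih os
    | some t :: os => simpa [foundPoints] using ih os

variable {k : ℕ} {q : ℝ} {X : Set E} {lab : E → Fin k} {Q : E → E → PMF SignType} {reps : List E}

/-- The law of the indices depends on the labels only. -/
theorem indexAll_map {L : Fin k → Fin k → PMF SignType}
    (hL : ∀ x ∈ X, ∀ y ∈ X, Q x y = L (lab x) (lab y)) {xs : List E} (hxs : ∀ x ∈ xs, x ∈ X)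
    (hreps : ∀ y ∈ reps, y ∈ X) :
    indexAll k Q xs reps = indexAll k L (xs.map lab) (reps.map lab) := by
  have hmapM : ∀ x ∈ X, ∀ ys : List E, (∀ y ∈ ys, y ∈ X) →
      (ys.map lab).mapM (L (lab x)) = ys.mapM (Q x) := by
    intro x hx ys
    induction ys with
    | nil => intro _; rfl
    | cons y ys ih =>
      intro hys
      rw [List.map_cons, mapM_pmf_cons, mapM_pmf_cons,
        ih fun z hz => hys z (List.mem_cons_of_mem _ hz), hL x hx y (hys y List.mem_cons_self)]
  induction xs generalizing reps with
  | nil => simp only [indexAll, List.map_nil]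
  | cons x xs ih =>
    have hx := hxs x List.mem_cons_self
    simp only [List.map_cons, indexAll]
    rw [hmapM x hx reps hreps]
    congr 1
    funext as
    rw [ih fun z hz => hxs z (List.mem_cons_of_mem _ hz)]
    · congr 2
      cases h : inferIndex k as with
      | none => rfl
      | some t =>
        simp only [extendKnown, List.length_map]
        split_ifs <;> simp
    · cases h : inferIndex k as with
      | none => exact hreps
      | some t =>
        simp only [extendKnown]
        split_ifs
        · exact hreps
        · intro y hy
          rcases List.mem_append.1 hy with hy | hy
          · exact hreps y hy
          · rw [List.mem_singleton.1 hy]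
            exact hx

theorem IsKnownList.extendKnown (hQ : IsLabelOracle q X lab Q) (hreps : IsKnownList X lab reps)
    {x : E} (hx : x ∈ X) {as : List SignType} (has : as ∈ (reps.mapM (Q x)).support) :
    IsKnownList X lab (extendKnown reps x (inferIndex k as)) ∧
      reps <+: extendKnown reps x (inferIndex k as) := by
  cases h : inferIndex k as with
  | none => exact ⟨hreps, List.prefix_rfl⟩
  | some t => exact ⟨(hreps.extend hQ hx has h).1, (hreps.extend hQ hx has h).2.1⟩

/-- The indices that cluster assignment finds are correct. -/
theorem assignAll_support (hQ : IsLabelOracle q X lab Q) {xs : List E} (hxs : ∀ x ∈ xs, x ∈ X)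
    (hreps : IsKnownList X lab reps) {res : List E × List (E × ℕ)}
    (hres : res ∈ (assignAll k Q xs reps).support) :
    IsKnownList X lab res.1 ∧ reps <+: res.1 ∧
      ∀ z ∈ res.2, z.1 ∈ xs ∧ (res.1.map lab)[z.2]? = some (lab z.1) := by
  induction xs generalizing reps res with
  | nil =>
    rw [assignAll_nil, PMF.support_pure, Set.mem_singleton_iff] at hres
    subst hres
    exact ⟨hreps, List.prefix_rfl, by simp⟩
  | cons x xs ih =>
    have hx := hxs x List.mem_cons_self
    rw [assignAll_cons, PMF.mem_support_bind_iff] at hres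
    obtain ⟨as, has, hres⟩ := hres
    rw [PMF.mem_support_bind_iff] at hres
    obtain ⟨res', hres', hres⟩ := hres
    rw [PMF.support_pure, Set.mem_singleton_iff] at hres
    obtain ⟨hknown, hpre⟩ := hreps.extendKnown hQ hx has
    obtain ⟨h1, h2, h3⟩ := ih (fun z hz => hxs z (List.mem_cons_of_mem _ hz)) hknown hres'
    have h3' : ∀ z ∈ res'.2, z.1 ∈ x :: xs ∧ (res'.1.map lab)[z.2]? = some (lab z.1) :=
      fun z hz => ⟨List.mem_cons_of_mem _ (h3 z hz).1, (h3 z hz).2⟩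
    cases h : inferIndex k as with
    | none =>
      rw [h] at hres
      subst hres
      exact ⟨h1, hpre.trans h2, h3'⟩
    | some t =>
      rw [h] at hres
      subst hres
      refine ⟨h1, hpre.trans h2, ?_⟩
      intro z hz
      rcases List.mem_cons.1 hz with rfl | hz
      · refine ⟨List.mem_cons_self, ?_⟩
        have h4 := (hreps.extend hQ hx has h).2.2
        rw [h] at h2
        -- Known points are only appended later on, so position `t` keeps its label in the final
        -- list.
        obtain ⟨s, hs⟩ := h2
        obtain ⟨hi, hv⟩ := List.getElem?_eq_some_iff.1 h4
        change (res'.1.map lab)[t]? = some (lab x)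
        rw [← hs, List.map_append, List.getElem?_append_left]
        · exact h4
        · exact hi
      · exact h3' z hz

/-- The number of points with label `a`. -/
def labelCount (lab : E → Fin k) (a : Fin k) (Z : List (E × ℕ)) : ℕ :=
  Z.countP fun z => lab z.1 = a

/-- Every sample point with label `a` is found with probability at least `q ^ (k - 1)`. -/
theorem expect_exp_labelCount_le (hQ : IsLabelOracle q X lab Q) (hq0 : 0 ≤ q) (hq1 : q ≤ 1)
    {c : ℝ} (hc : 0 ≤ c) (a : Fin k) {xs : List E} (hxs : ∀ x ∈ xs, x ∈ X)
    (hreps : IsKnownList X lab reps) :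
    (assignAll k Q xs reps).expect
        (fun res => ENNReal.ofReal (Real.exp (-c)) ^ labelCount lab a res.2) ≤
      ENNReal.ofReal (1 - q ^ (k - 1) + q ^ (k - 1) * Real.exp (-c)) ^
        (xs.countP fun x => lab x = a) := by
  set e := ENNReal.ofReal (Real.exp (-c)) with he
  have he1 : e ≤ 1 := by
    rw [he, ← ENNReal.ofReal_one]
    exact ENNReal.ofReal_le_ofReal (Real.exp_le_one_iff.2 (by linarith))
  set ρ := ENNReal.ofReal (1 - q ^ (k - 1) + q ^ (k - 1) * Real.exp (-c)) with hρ
  induction xs generalizing reps with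
  | nil =>
    rw [assignAll_nil, PMF.expect_pure]
    simp [labelCount]
  | cons x xs ih =>
    have hx := hxs x List.mem_cons_self
    have hxs' : ∀ z ∈ xs, z ∈ X := fun z hz => hxs z (List.mem_cons_of_mem _ hz)
    simp only [assignAll_cons, PMF.expect_bind, PMF.expect_pure]
    set N := xs.countP fun x => lab x = a with hN
    by_cases hxa : lab x = a
    -- The point `x` contributes the factor `e` if its index is found and 1 otherwise, that is, `e`
    -- plus (1 - e) times the indicator of not being found. The bound for that indicator holds for
    -- every list of known points, so the dependence on earlier answers does no harm.
    · have hstep : ∀ as ∈ (reps.mapM (Q x)).support,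
          (assignAll k Q xs (extendKnown reps x (inferIndex k as))).expect
            (fun res => e ^ labelCount lab a (consFound x (inferIndex k as) res).2) ≤
          (e + (1 - e) * {as | inferIndex k as = none}.indicator 1 as) * ρ ^ N := by
        intro as has
        have hih := ih hxs' (hreps.extendKnown hQ hx has).1
        cases h : inferIndex k as with
        | none =>
          rw [h] at hih
          rw [Set.indicator_of_mem (show as ∈ {as | inferIndex k as = none} from h), Pi.one_apply, mul_one, add_tsub_cancel_of_le he1, one_mul]
          exact hih
        | some t =>
          rw [h] at hih
          rw [Set.indicator_of_notMem (by simp [h]), mul_zero, add_zero]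
          have : ∀ res : List E × List (E × ℕ), e ^ labelCount lab a (consFound x (some t) res).2 =
              e * e ^ labelCount lab a res.2 := by
            intro res
            simp [labelCount, consFound, hxa, pow_succ']
          simp only [this, PMF.expect_const_mul]
          gcongr
      refine (PMF.expect_mono hstep).trans ?_
      rw [PMF.expect_mul_const, PMF.expect_add, PMF.expect_const, PMF.expect_const_mul,
        List.countP_cons_of_pos (by simpa using hxa), ← hN, pow_succ']
      gcongr
      calc _ ≤ e + (1 - e) * ENNReal.ofReal (1 - q ^ (k - 1)) := by
            gcongr
            exact expect_inferIndex_none_le hQ hq0 hq1 hreps hx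
        _ = ρ := by
            have hpow : q ^ (k - 1) ≤ 1 := pow_le_one₀ hq0 hq1
            have hexp : Real.exp (-c) ≤ 1 := Real.exp_le_one_iff.2 (by linarith)
            have hexp0 := Real.exp_pos (-c)
            rw [he, hρ, ← ENNReal.ofReal_one, ← ENNReal.ofReal_sub _ hexp0.le,
              ← ENNReal.ofReal_mul (by linarith), ← ENNReal.ofReal_add hexp0.le
                (mul_nonneg (by linarith) (by linarith))]
            congr 1
            ring
    · rw [List.countP_cons_of_neg (by simpa using hxa)]
      refine PMF.expect_le fun as has => ?_
      have hih := ih hxs' (hreps.extendKnown hQ hx has).1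
      refine le_trans (PMF.expect_mono fun res _ => ?_) hih
      cases h : inferIndex k as <;> simp [labelCount, consFound, hxa]

end Assignment

/-! ### Deviation of the sample means -/

section Deviation

variable {F : Type} [NormedAddCommGroup F] {k : ℕ}

/-- The sum of the deviations from `μ` of the points with label `a`. -/
def labelDeviation (lab : F → Fin k) (a : Fin k) (μ : F) (Z : List (F × ℕ)) : F :=
  ((Z.filter fun z => lab z.1 = a).map fun z => z.1 - μ).sum

theorem drawIID_succ {E : Type} (p : PMF E) (n : ℕ) :
    drawIID p (n + 1) = p.bind fun x => (drawIID p n).bind fun xs => PMF.pure (x :: xs) := rfl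

theorem drawIID_support {E : Type} {p : PMF E} {n : ℕ} {xs : List E}
    (h : xs ∈ (drawIID p n).support) : xs.length = n ∧ ∀ x ∈ xs, x ∈ p.support := by
  induction n generalizing xs with
  | zero =>
    have h : xs ∈ (PMF.pure ([] : List E)).support := h
    rw [PMF.support_pure, Set.mem_singleton_iff] at h
    subst h
    simp
  | succ n ih =>
    rw [drawIID_succ, PMF.mem_support_bind_iff] at h
    obtain ⟨x, hx, h⟩ := h
    rw [PMF.mem_support_bind_iff] at h
    obtain ⟨xs', hxs', h⟩ := h
    rw [PMF.support_pure, Set.mem_singleton_iff] at h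
    subst h
    obtain ⟨h1, h2⟩ := ih hxs'
    refine ⟨by simp [h1], ?_⟩
    intro y hy
    rcases List.mem_cons.1 hy with rfl | hy
    · exact hx
    · exact h2 y hy

variable [InnerProductSpace ℝ F] {lab : F → Fin k} {a : Fin k} {μ : F} {l R c : ℝ}
  {S : Finset F}

/-- The effect of one sampled point whose index is found. The weight `G` is constant on the cluster,
so the positions can be averaged by the centered `cosh` bound; the loss e^c uses up half of the
exponent of e^{-2c}. -/
theorem sum_ite_cosh_le (hR : 0 ≤ R) (hbd : ∀ x ∈ S, lab x = a → ‖x - μ‖ ≤ R)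
    (hsum : ∑ x ∈ S.filter (fun x => lab x = a), (x - μ) = 0)
    (hcosh : Real.cosh (l * R) ≤ Real.exp c) (G : Fin k → ℝ≥0∞) (v : F) :
    ∑ x ∈ S, (if lab x = a then ENNReal.ofReal (Real.exp (-(2 * c))) *
        ENNReal.ofReal (Real.cosh (l * ‖v + (x - μ)‖)) else
        ENNReal.ofReal (Real.cosh (l * ‖v‖))) * G (lab x) ≤
      ENNReal.ofReal (Real.cosh (l * ‖v‖)) *
        ∑ x ∈ S, (if lab x = a then ENNReal.ofReal (Real.exp (-c)) else 1) * G (lab x) := by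
  rw [← Finset.sum_filter_add_sum_filter_not S (fun x => lab x = a),
    ← Finset.sum_filter_add_sum_filter_not S (fun x => lab x = a), mul_add]
  refine add_le_add ?_ ?_
  · calc _ = ∑ x ∈ S.filter (fun x => lab x = a), ENNReal.ofReal (Real.cosh (l * ‖v + (x - μ)‖)) *
              (ENNReal.ofReal (Real.exp (-(2 * c))) * G a) := by
          refine Finset.sum_congr rfl fun x hx => ?_
          rw [Finset.mem_filter] at hx
          rw [if_pos hx.2, hx.2]
          ring
      _ = ENNReal.ofReal (∑ x ∈ S.filter (fun x => lab x = a), Real.cosh (l * ‖v + (x - μ)‖)) *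
              (ENNReal.ofReal (Real.exp (-(2 * c))) * G a) := by
          rw [← Finset.sum_mul, ENNReal.ofReal_sum_of_nonneg fun _ _ => (Real.cosh_pos _).le]
      _ ≤ ENNReal.ofReal ((S.filter (fun x => lab x = a)).card *
            (Real.cosh (l * ‖v‖) * Real.exp c)) *
              (ENNReal.ofReal (Real.exp (-(2 * c))) * G a) := by
          gcongr
          refine (sum_cosh_norm_add_le hR v _ (fun x => x - μ) (fun x hx => ?_) hsum).trans ?_
          · rw [Finset.mem_filter] at hx
            exact hbd x hx.1 hx.2
          · have := Real.cosh_pos (l * ‖v‖)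
            gcongr
      _ = ENNReal.ofReal (Real.cosh (l * ‖v‖)) * ∑ x ∈ S.filter (fun x => lab x = a),
            ENNReal.ofReal (Real.exp (-c)) * G a := by
          have hexp : Real.exp (-c) = Real.exp c * Real.exp (-(2 * c)) := by
            rw [← Real.exp_add]
            ring_nf
          rw [Finset.sum_const, nsmul_eq_mul, hexp, ENNReal.ofReal_mul (by positivity),
            ENNReal.ofReal_mul (Real.cosh_pos _).le, ENNReal.ofReal_mul (Real.exp_pos _).le,
            ENNReal.ofReal_natCast]
          ring
      _ = _ := by
          congr 1
          refine Finset.sum_congr rfl fun x hx => ?_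
          rw [Finset.mem_filter] at hx
          rw [if_pos hx.2, hx.2]
  · rw [Finset.mul_sum]
    refine (Finset.sum_congr rfl fun x hx => ?_).le
    rw [Finset.mem_filter] at hx
    rw [if_neg hx.2, if_neg hx.2, one_mul]

theorem foundPoints_nil_right {E : Type} (xs : List E) : foundPoints xs [] = [] := by
  cases xs <;> rfl

/-- For fixed indices, the exponential moment of the deviation under independent sampling, with a
weight that depends on the labels only. -/
theorem expect_drawIID_cosh_le (hS : S.Nonempty) (hR : 0 ≤ R)
    (hbd : ∀ x ∈ S, lab x = a → ‖x - μ‖ ≤ R)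
    (hsum : ∑ x ∈ S.filter (fun x => lab x = a), (x - μ) = 0)
    (hcosh : Real.cosh (l * R) ≤ Real.exp c) (n : ℕ) (os : List (Option ℕ))
    (g : List (Fin k) → ℝ≥0∞) (v : F) :
    (drawIID (PMF.uniformOfFinset S hS) n).expect (fun xs => g (xs.map lab) *
        (ENNReal.ofReal (Real.exp (-(2 * c))) ^ labelCount lab a (foundPoints xs os) *
          ENNReal.ofReal (Real.cosh (l * ‖v + labelDeviation lab a μ (foundPoints xs os)‖)))) ≤
      ENNReal.ofReal (Real.cosh (l * ‖v‖)) *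
        (drawIID (PMF.uniformOfFinset S hS) n).expect (fun xs => g (xs.map lab) *
          ENNReal.ofReal (Real.exp (-c)) ^ labelCount lab a (foundPoints xs os)) := by
  induction n generalizing os g v with
  | zero =>
    change (PMF.pure []).expect _ ≤ _ * (PMF.pure []).expect _
    rw [PMF.expect_pure, PMF.expect_pure]
    simp [foundPoints, labelCount, labelDeviation, mul_comm]
  | succ n ih =>
    match os with
    | [] =>
      rw [← PMF.expect_const_mul]
      refine PMF.expect_mono fun xs _ => ?_
      simp [foundPoints_nil_right, labelCount, labelDeviation, mul_comm]
    | none :: os =>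
      simp only [drawIID_succ, PMF.expect_bind, PMF.expect_pure]
      rw [← PMF.expect_const_mul]
      refine PMF.expect_mono fun x _ => ?_
      exact ih os (fun ls => g (lab x :: ls)) v
    | some t :: os =>
      simp only [drawIID_succ, PMF.expect_bind, PMF.expect_pure]
      set p := drawIID (PMF.uniformOfFinset S hS) n with hp
      set e1 := ENNReal.ofReal (Real.exp (-c)) with he1
      set e2 := ENNReal.ofReal (Real.exp (-(2 * c))) with he2
      -- The contribution of the remaining sample, given the first label. It does not see the
      -- position of the first point, which is therefore free to be averaged.
      set G : Fin k → ℝ≥0∞ := fun i => p.expect fun xs =>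
        g (i :: xs.map lab) * e1 ^ labelCount lab a (foundPoints xs os) with hG
      have hcount : ∀ x xs, labelCount lab a (foundPoints (x :: xs) (some t :: os)) =
          labelCount lab a (foundPoints xs os) + if lab x = a then 1 else 0 := by
        intro x xs
        simp [foundPoints, labelCount, List.countP_cons]
      have hdev : ∀ x xs, labelDeviation lab a μ (foundPoints (x :: xs) (some t :: os)) =
          (if lab x = a then x - μ else 0) + labelDeviation lab a μ (foundPoints xs os) := by
        intro x xs
        by_cases hx : lab x = a <;> simp [foundPoints, labelDeviation, hx]
      calc _ ≤ (PMF.uniformOfFinset S hS).expect (fun x => (if lab x = a then e2 *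
                  ENNReal.ofReal (Real.cosh (l * ‖v + (x - μ)‖)) else
                  ENNReal.ofReal (Real.cosh (l * ‖v‖))) * G (lab x)) := by
            refine PMF.expect_mono fun x _ => ?_
            by_cases hx : lab x = a
            -- The deviation of `x` is absorbed into the starting vector `v`.
            · have h := ih os (fun ls => g (lab x :: ls)) (v + (x - μ))
              simp only [hcount, hdev, if_pos hx]
              rw [mul_assoc]
              refine le_trans (le_of_eq ?_) (mul_le_mul_right h e2)
              rw [← PMF.expect_const_mul]
              congr 1
              funext xs
              rw [pow_succ, add_assoc v, List.map_cons]
              ring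
            · have h := ih os (fun ls => g (lab x :: ls)) v
              simp only [hcount, hdev, if_neg hx, zero_add, add_zero]
              exact h
        _ ≤ ENNReal.ofReal (Real.cosh (l * ‖v‖)) * (PMF.uniformOfFinset S hS).expect
              (fun x => (if lab x = a then e1 else 1) * G (lab x)) := by
            rw [PMF.expect_uniformOfFinset, PMF.expect_uniformOfFinset, mul_left_comm]
            gcongr
            exact sum_ite_cosh_le hR hbd hsum hcosh G v
        _ = _ := by
            congr 2
            funext x
            rw [hG, ← PMF.expect_const_mul]
            congr 1
            funext xs
            rw [hcount]
            by_cases hx : lab x = a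
            · simp only [hx, if_true, pow_succ, List.map_cons]
              ring
            · simp [hx]

/-- The exponential moment of the deviation of the points with label `a` that are found, with a
weight that depends on the labels and indices of the points that are found. -/
theorem expect_assignAll_cosh_le {q : ℝ} {X : Set F} {Q : F → F → PMF SignType}
    {reps : List F} (hS : S.Nonempty) (hR : 0 ≤ R) (hbd : ∀ x ∈ S, lab x = a → ‖x - μ‖ ≤ R)
    (hsum : ∑ x ∈ S.filter (fun x => lab x = a), (x - μ) = 0)
    (hcosh : Real.cosh (l * R) ≤ Real.exp c) (hQ : IsLabelOracle q X lab Q)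
    (hlab : ∀ i, ∃ x ∈ X, lab x = i) (hSX : ∀ x ∈ S, x ∈ X) (hreps : ∀ y ∈ reps, y ∈ X) (n : ℕ)
    (w : List (Fin k × ℕ) → ℝ≥0∞) :
    (drawIID (PMF.uniformOfFinset S hS) n).expect (fun xs => (assignAll k Q xs reps).expect
        fun res => w (res.2.map (Prod.map lab id)) *
        (ENNReal.ofReal (Real.exp (-(2 * c))) ^ labelCount lab a res.2 *
          ENNReal.ofReal (Real.cosh (l * ‖labelDeviation lab a μ res.2‖)))) ≤
      (drawIID (PMF.uniformOfFinset S hS) n).expect (fun xs => (assignAll k Q xs reps).expect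
        fun res => w (res.2.map (Prod.map lab id)) *
          ENNReal.ofReal (Real.exp (-c)) ^ labelCount lab a res.2) := by
  -- One representative per label turns the oracle into a function of labels.
  choose pt hptX hpt using hlab
  set L : Fin k → Fin k → PMF SignType := fun i j => Q (pt i) (pt j) with hLdef
  have hL : ∀ x ∈ X, ∀ y ∈ X, Q x y = L (lab x) (lab y) := fun x hx y hy =>
    hQ.congr x hx _ (hptX _) y hy _ (hptX _) (hpt _).symm (hpt _).symm
  -- Summing over the possible index lists makes the probability of each list a weight that depends
  -- on the labels only; the bound for fixed indices then applies term by term.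
  have key : ∀ f : List (F × ℕ) → ℝ≥0∞,
      (drawIID (PMF.uniformOfFinset S hS) n).expect (fun xs => (assignAll k Q xs reps).expect
        fun res => w (res.2.map (Prod.map lab id)) * f res.2) =
      ∑' os, (drawIID (PMF.uniformOfFinset S hS) n).expect fun xs =>
        (indexAll k L (xs.map lab) (reps.map lab) os * w (foundPoints (xs.map lab) os)) *
          f (foundPoints xs os) := by
    intro f
    rw [← PMF.expect_tsum]
    refine PMF.expect_congr fun xs hxs => ?_
    rw [expect_assignAll_snd k Q xs reps fun Z => w (Z.map (Prod.map lab id)) * f Z,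
      indexAll_map hL (fun x hx => hSX x ?_) hreps, PMF.expect]
    · refine tsum_congr fun os => ?_
      rw [foundPoints_map, mul_assoc]
    · have := (drawIID_support hxs).2 x hx
      rwa [PMF.mem_support_uniformOfFinset_iff] at this
  rw [key fun Z => ENNReal.ofReal (Real.exp (-(2 * c))) ^ labelCount lab a Z *
      ENNReal.ofReal (Real.cosh (l * ‖labelDeviation lab a μ Z‖)),
    key fun Z => ENNReal.ofReal (Real.exp (-c)) ^ labelCount lab a Z]
  refine ENNReal.tsum_le_tsum fun os => ?_
  have h := expect_drawIID_cosh_le hS hR hbd hsum hcosh n os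
    (fun ls => indexAll k L ls (reps.map lab) os * w (foundPoints ls os)) 0
  simpa using h

end Deviation

/-! ### The sampling phase -/

section Sampling

variable {F : Type} {k : ℕ}

/-- Points have the same index exactly if they have the same label. -/
structure IsConsistent (k : ℕ) (lab : F → Fin k) (Z : List (F × ℕ)) : Prop where
  lt : ∀ z ∈ Z, z.2 < k
  iff : ∀ z ∈ Z, ∀ z' ∈ Z, z.2 = z'.2 ↔ lab z.1 = lab z'.1

/-- An index is the position of the label in the final list of known points, which has at most k
entries and no repeated label. -/
theorem assignAll_isConsistent {q : ℝ} {X : Set F} {lab : F → Fin k} {Q : F → F → PMF SignType}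
    {reps xs : List F} (hQ : IsLabelOracle q X lab Q) (hxs : ∀ x ∈ xs, x ∈ X)
    (hreps : IsKnownList X lab reps) {res : List F × List (F × ℕ)}
    (hres : res ∈ (assignAll k Q xs reps).support) : IsConsistent k lab res.2 := by
  obtain ⟨h1, -, h3⟩ := assignAll_support hQ hxs hreps hres
  refine ⟨fun z hz => ?_, fun z hz z' hz' => ?_⟩
  · obtain ⟨hi, -⟩ := List.getElem?_eq_some_iff.1 (h3 z hz).2
    rw [List.length_map] at hi
    exact hi.trans_le h1.length_le
  · have hz1 := (h3 z hz).2
    have hz2 := (h3 z' hz').2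
    obtain ⟨hi, -⟩ := List.getElem?_eq_some_iff.1 hz1
    constructor
    · intro h
      rw [h, hz2] at hz1
      exact (Option.some.inj hz1).symm
    · intro h
      exact (List.getElem?_inj (by simpa using hi) h1.nodup).1 (by rw [hz1, hz2, h])

/-- The index with the most points. -/
def selectedIndex (k : ℕ) (Z : List (F × ℕ)) : Option ℕ :=
  (List.range k).argmax fun t => (pointsWithIndex Z t).length

/-- The label of the points with the selected index. -/
def selectedLabel (P : List (Fin k × ℕ)) : Option (Fin k) :=
  (selectedIndex k P).bind fun p => (pointsWithIndex P p).head?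

theorem pointsWithIndex_map {G : Type} (f : F → G) (Z : List (F × ℕ)) (t : ℕ) :
    pointsWithIndex (Z.map (Prod.map f id)) t = (pointsWithIndex Z t).map f := by
  simp [pointsWithIndex, List.filter_map, Function.comp_def]

theorem selectedIndex_map {G : Type} (f : F → G) (Z : List (F × ℕ)) :
    selectedIndex k (Z.map (Prod.map f id)) = selectedIndex k Z := by
  simp [selectedIndex, pointsWithIndex_map]

/-- The selection uses labels and indices only, so the event that a given label is selected is an
admissible weight in `expect_assignAll_cosh_le`. -/
theorem selectedLabel_map (lab : F → Fin k) (Z : List (F × ℕ)) {p : ℕ}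
    (hp : selectedIndex k Z = some p) :
    selectedLabel (Z.map (Prod.map lab id)) = (pointsWithIndex Z p).head?.map lab := by
  rw [selectedLabel, selectedIndex_map, hp, Option.bind_some, pointsWithIndex_map, List.head?_map]

theorem exists_selectedIndex (hk : 0 < k) (Z : List (F × ℕ)) :
    ∃ p, selectedIndex k Z = some p := by
  rw [← Option.ne_none_iff_exists', selectedIndex, Ne, List.argmax_eq_none, List.range_eq_nil]
  exact hk.ne'

theorem mem_pointsWithIndex {Z : List (F × ℕ)} {t : ℕ} {x : F} :
    x ∈ pointsWithIndex Z t ↔ (x, t) ∈ Z := by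
  simp [pointsWithIndex]

theorem IsConsistent.filter_eq {lab : F → Fin k} {Z : List (F × ℕ)} (h : IsConsistent k lab Z)
    {x : F} {t : ℕ} (hx : (x, t) ∈ Z) :
    (Z.filter fun z => lab z.1 = lab x) = Z.filter fun z => z.2 = t := by
  refine List.filter_congr fun z hz => ?_
  have := h.iff _ hx z hz
  simp only [decide_eq_decide]
  rw [eq_comm, ← this, eq_comm]

theorem IsConsistent.labelCount_eq {lab : F → Fin k} {Z : List (F × ℕ)}
    (h : IsConsistent k lab Z) {x : F} {t : ℕ} (hx : (x, t) ∈ Z) :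
    labelCount lab (lab x) Z = (pointsWithIndex Z t).length := by
  rw [labelCount, List.countP_eq_length_filter, h.filter_eq hx, pointsWithIndex, List.length_map]

theorem IsConsistent.labelCount_le {lab : F → Fin k} {Z : List (F × ℕ)}
    (h : IsConsistent k lab Z) {p : ℕ} (hp : selectedIndex k Z = some p) (b : Fin k) :
    labelCount lab b Z ≤ (pointsWithIndex Z p).length := by
  by_cases hb : ∃ z ∈ Z, lab z.1 = b
  · obtain ⟨⟨x, t⟩, hz, rfl⟩ := hb
    rw [h.labelCount_eq hz]
    exact List.le_of_mem_argmax (f := fun t => (pointsWithIndex Z t).length)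
      (List.mem_range.2 (h.lt _ hz)) hp
  · have : labelCount lab b Z = 0 := by
      rw [labelCount, List.countP_eq_zero]
      intro z hz hzb
      exact hb ⟨z, hz, by simpa using hzb⟩
    omega

theorem sum_countP_eq_length (lab : F → Fin k) (xs : List F) :
    ∑ b, (xs.countP fun x => lab x = b) = xs.length := by
  induction xs with
  | nil => simp
  | cons x xs ih => simp [List.countP_cons, Finset.sum_add_distrib, ih]

theorem exists_length_le_mul_countP (hk : 0 < k) (lab : F → Fin k) (xs : List F) :
    ∃ b, xs.length ≤ k * xs.countP fun x => lab x = b := by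
  have : Nonempty (Fin k) := ⟨⟨0, hk⟩⟩
  by_contra! h
  have h1 : ∑ b : Fin k, k * (xs.countP fun x => lab x = b) < ∑ _b : Fin k, xs.length :=
    Finset.sum_lt_sum_of_nonempty Finset.univ_nonempty fun b _ => h b
  rw [← Finset.mul_sum, sum_countP_eq_length] at h1
  simp at h1

/-- Exactly one of the indicators is 1, so the sum over labels has a single term, and the selected
label has at least as many found points as `b`. If no label is selected, no point was found at all
and the right side is 1. -/
theorem selected_moment_le (hk : 0 < k) {lab : F → Fin k} {Z : List (F × ℕ)}
    (hZ : IsConsistent k lab Z) {e : ℝ≥0∞} (he : e ≤ 1) (b : Fin k) :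
    (∑ a, ({P | selectedLabel P = some a}.indicator 1 (Z.map (Prod.map lab id)) *
        e ^ labelCount lab a Z)) +
      {P | selectedLabel P = none}.indicator 1 (Z.map (Prod.map lab id)) ≤
      e ^ labelCount lab b Z := by
  obtain ⟨p, hp⟩ := exists_selectedIndex hk Z
  have hsel := selectedLabel_map lab Z hp
  have hle := hZ.labelCount_le hp b
  cases hhead : (pointsWithIndex Z p).head? with
  | none =>
    rw [hhead, Option.map_none] at hsel
    rw [List.head?_eq_none_iff] at hhead
    rw [hhead, List.length_nil, Nat.le_zero] at hle
    rw [hle]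
    simp [Set.indicator, hsel]
  | some x =>
    rw [hhead, Option.map_some] at hsel
    have hx := mem_pointsWithIndex.1 (List.mem_of_head? hhead)
    rw [← hZ.labelCount_eq hx] at hle
    rw [Finset.sum_eq_single (lab x)]
    · simpa [Set.indicator, hsel] using pow_le_pow_right_of_le_one' he hle
    · intro a _ ha
      simp [Set.indicator, hsel, ha.symm]
    · simp

variable [NormedAddCommGroup F]

theorem IsConsistent.labelDeviation_eq {lab : F → Fin k} {Z : List (F × ℕ)}
    (h : IsConsistent k lab Z) {x : F} {t : ℕ} (hx : (x, t) ∈ Z) (μ : F) :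
    labelDeviation lab (lab x) μ Z =
      (pointsWithIndex Z t).sum - (pointsWithIndex Z t).length • μ := by
  rw [labelDeviation, h.filter_eq hx, pointsWithIndex]
  induction Z.filter fun z => z.2 = t with
  | nil => simp
  | cons z Z ih =>
    simp only [List.map_cons, List.sum_cons, ih, List.length_cons, succ_nsmul]
    abel

variable [InnerProductSpace ℝ F]

/-- There are points with the selected index, they are in one cluster, and their mean is close to
the center of that cluster. -/
def IsAccurate (k : ℕ) (lab : F → Fin k) (μ : Fin k → F) (ε : Fin k → ℝ) (Z : List (F × ℕ)) :
    Prop :=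
  ∀ p, selectedIndex k Z = some p → pointsWithIndex Z p ≠ [] ∧
    ∃ a, (∀ y ∈ pointsWithIndex Z p, lab y = a) ∧
      ‖((pointsWithIndex Z p).length : ℝ)⁻¹ • (pointsWithIndex Z p).sum - μ a‖ ≤ ε a

/-- With l = s/(2R), a deviation of at least n·sR/2 gives l·d ≥ n·s²/4, which is the exponent to be
compensated. The factor 2 comes from exp x ≤ 2 cosh x. -/
theorem one_le_two_mul_exp_mul_cosh {n : ℕ} {s R d : ℝ} (hR : 0 < R) (hs : 0 < s)
    (hd : n * (s / 2 * R) ≤ d) :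
    1 ≤ 2 * (Real.exp (-(2 * (s ^ 2 / 8))) ^ n * Real.cosh (s / (2 * R) * d)) := by
  have h1 : n * (2 * (s ^ 2 / 8)) ≤ s / (2 * R) * d := by
    calc n * (2 * (s ^ 2 / 8)) = s / (2 * R) * (n * (s / 2 * R)) := by
          field_simp
          ring
      _ ≤ _ := by gcongr
  have h2 : Real.exp (n * (2 * (s ^ 2 / 8))) ≤ 2 * Real.cosh (s / (2 * R) * d) := by
    rw [Real.cosh_eq]
    have := Real.exp_le_exp.2 h1
    have := Real.exp_pos (-(s / (2 * R) * d))
    linarith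
  calc (1 : ℝ) = Real.exp (-(2 * (s ^ 2 / 8))) ^ n * Real.exp (n * (2 * (s ^ 2 / 8))) := by
        rw [← Real.exp_nat_mul, ← Real.exp_add, ← Real.exp_zero]
        ring_nf
    _ ≤ Real.exp (-(2 * (s ^ 2 / 8))) ^ n * (2 * Real.cosh (s / (2 * R) * d)) := by gcongr
    _ = _ := by ring

/-- A failure of the sampling phase, bounded by exponential moments. -/
theorem indicator_not_isAccurate_le (hk : 0 < k) {lab : F → Fin k} {μ : Fin k → F}
    {R : Fin k → ℝ} {s : ℝ} (hs : 0 < s) (hR : ∀ a, 0 ≤ R a) {K : ℝ} (hK1 : 1 ≤ K)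
    (hK2 : ∀ a, 0 < R a → 2 ≤ K) {Z : List (F × ℕ)} (hZ : IsConsistent k lab Z)
    (hbd : ∀ z ∈ Z, ‖z.1 - μ (lab z.1)‖ ≤ R (lab z.1)) :
    {Z | ¬ IsAccurate k lab μ (fun a => s / 2 * R a) Z}.indicator 1 Z ≤
      ENNReal.ofReal K * (∑ a, ({P | selectedLabel P = some a}.indicator 1 (Z.map (Prod.map lab id))
        * (ENNReal.ofReal (Real.exp (-(2 * (s ^ 2 / 8)))) ^ labelCount lab a Z *
          ENNReal.ofReal (Real.cosh (s / (2 * R a) * ‖labelDeviation lab a (μ a) Z‖)))) +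
        {P | selectedLabel P = none}.indicator 1 (Z.map (Prod.map lab id))) := by
  by_cases hacc : IsAccurate k lab μ (fun a => s / 2 * R a) Z
  · rw [Set.indicator_of_notMem (by simpa using hacc)]
    exact zero_le
  rw [Set.indicator_of_mem (by simpa using hacc), Pi.one_apply]
  obtain ⟨p, hp⟩ := exists_selectedIndex hk Z
  have hsel := selectedLabel_map lab Z hp
  have hK1' : 1 ≤ ENNReal.ofReal K := ENNReal.one_le_ofReal.2 hK1
  cases hhead : (pointsWithIndex Z p).head? with
  | none =>
    rw [hhead, Option.map_none] at hsel
    -- An empty selection is charged to the last indicator, for which K ≥ 1 suffices.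
    calc (1 : ℝ≥0∞) ≤ ENNReal.ofReal K * 1 := by simpa using hK1'
      _ ≤ _ := by
        gcongr
        rw [Set.indicator_of_mem (show _ ∈ {P | selectedLabel P = none} from hsel)]
        exact le_add_self
  | some x =>
    rw [hhead, Option.map_some] at hsel
    have hxp : x ∈ pointsWithIndex Z p := List.mem_of_head? hhead
    have hx := mem_pointsWithIndex.1 hxp
    have hcount := hZ.labelCount_eq hx
    have hdev := hZ.labelDeviation_eq hx (μ (lab x))
    set n := (pointsWithIndex Z p).length with hn
    have hnpos : 0 < n := List.length_pos_of_mem hxp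
    have hn' : (n : ℝ) ≠ 0 := by positivity
    have hmean : (n : ℝ)⁻¹ • (pointsWithIndex Z p).sum - μ (lab x) =
        (n : ℝ)⁻¹ • labelDeviation lab (lab x) (μ (lab x)) Z := by
      rw [hdev, smul_sub, ← Nat.cast_smul_eq_nsmul ℝ, smul_smul, inv_mul_cancel₀ hn', one_smul]
    have hfar : n * (s / 2 * R (lab x)) < ‖labelDeviation lab (lab x) (μ (lab x)) Z‖ := by
      by_contra! hle
      refine hacc fun p' hp' => ?_
      obtain rfl : p = p' := by simpa [hp] using hp'
      refine ⟨List.ne_nil_of_mem hxp, lab x, fun y hy => ?_, ?_⟩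
      · exact ((hZ.iff _ (mem_pointsWithIndex.1 hy) _ hx).1 rfl)
      · rw [← hn, hmean, norm_smul, norm_inv, Real.norm_natCast, inv_mul_le_iff₀ (by positivity)]
        exact hle
    -- In a cluster of radius 0 all deviations vanish, so an inaccurate mean forces R > 0, and then
    -- K ≥ 2 pays for the factor 2.
    have hRpos : 0 < R (lab x) := by
      refine (hR _).lt_of_ne fun h0 => ?_
      refine absurd hfar (not_lt.2 ?_)
      have : labelDeviation lab (lab x) (μ (lab x)) Z = 0 := by
        refine List.sum_eq_zero fun y hy => ?_
        obtain ⟨z, hz, rfl⟩ := List.mem_map.1 hy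
        rw [List.mem_filter] at hz
        have hzl : lab z.1 = lab x := by simpa using hz.2
        have := hbd z hz.1
        rw [hzl, ← h0] at this
        exact norm_le_zero_iff.1 this
      rw [this, ← h0]
      simp
    have hK := hK2 _ hRpos
    calc (1 : ℝ≥0∞) ≤ ENNReal.ofReal (2 * (Real.exp (-(2 * (s ^ 2 / 8))) ^ n *
          Real.cosh (s / (2 * R (lab x)) * ‖labelDeviation lab (lab x) (μ (lab x)) Z‖))) :=
          ENNReal.one_le_ofReal.2 (one_le_two_mul_exp_mul_cosh hRpos hs hfar.le)
      _ ≤ ENNReal.ofReal (K * (Real.exp (-(2 * (s ^ 2 / 8))) ^ n *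
          Real.cosh (s / (2 * R (lab x)) * ‖labelDeviation lab (lab x) (μ (lab x)) Z‖))) := by
          have := Real.cosh_pos (s / (2 * R (lab x)) *
            ‖labelDeviation lab (lab x) (μ (lab x)) Z‖)
          refine ENNReal.ofReal_le_ofReal ?_
          gcongr
      _ = ENNReal.ofReal K * (ENNReal.ofReal (Real.exp (-(2 * (s ^ 2 / 8)))) ^ n *
          ENNReal.ofReal
            (Real.cosh (s / (2 * R (lab x)) * ‖labelDeviation lab (lab x) (μ (lab x)) Z‖))) := by
          rw [ENNReal.ofReal_mul (by linarith), ENNReal.ofReal_mul (by positivity),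
            ENNReal.ofReal_pow (Real.exp_pos _).le]
      _ ≤ _ := by
          gcongr
          refine le_trans ?_ le_self_add
          refine le_trans ?_ (Finset.single_le_sum (fun _ _ => zero_le) (Finset.mem_univ (lab x)))
          rw [Set.indicator_of_mem (show _ ∈ {P | selectedLabel P = some (lab x)} from hsel),
            Pi.one_apply, one_mul, hcount]

/-- The sampling phase fails with small probability. -/
theorem expect_not_isAccurate_le (hk : 0 < k) {q : ℝ} (hq0 : 0 ≤ q) (hq1 : q ≤ 1) {X : Set F}
    {lab : F → Fin k} {Q : F → F → PMF SignType} {reps : List F} {μ : Fin k → F} {R : Fin k → ℝ}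
    {s : ℝ} (hs : 0 < s) (hR : ∀ a, 0 ≤ R a) {K : ℝ} (hK1 : 1 ≤ K)
    (hK2 : ∀ a, 0 < R a → 2 ≤ K) {S : Finset F} (hS : S.Nonempty)
    (hbd : ∀ x ∈ S, ‖x - μ (lab x)‖ ≤ R (lab x))
    (hsum : ∀ a, ∑ x ∈ S.filter (fun x => lab x = a), (x - μ a) = 0)
    (hQ : IsLabelOracle q X lab Q) (hlab : ∀ i, ∃ x ∈ X, lab x = i) (hSX : ∀ x ∈ S, x ∈ X)
    (hreps : IsKnownList X lab reps) {n : ℕ} {T : ℝ≥0∞}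
    (hT : ∀ N : ℕ, n ≤ k * N → ENNReal.ofReal K *
      ENNReal.ofReal (1 - q ^ (k - 1) + q ^ (k - 1) * Real.exp (-(s ^ 2 / 8))) ^ N ≤ T) :
    (drawIID (PMF.uniformOfFinset S hS) n).expect (fun xs => (assignAll k Q xs reps).expect
      fun res => {Z | ¬ IsAccurate k lab μ (fun a => s / 2 * R a) Z}.indicator 1 res.2) ≤ T := by
  set c := s ^ 2 / 8 with hc
  set p := drawIID (PMF.uniformOfFinset S hS) n with hp
  have hxsS : ∀ xs ∈ p.support, ∀ x ∈ xs, x ∈ S := by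
    intro xs hxs x hx
    have := (drawIID_support hxs).2 x hx
    rwa [PMF.mem_support_uniformOfFinset_iff] at this
  have hxsX : ∀ xs ∈ p.support, ∀ x ∈ xs, x ∈ X := fun xs hxs x hx => hSX x (hxsS xs hxs x hx)
  -- The inequality cosh x ≤ exp(x²/2) at x = s/2 is the origin of c = s²/8. For R = 0 the argument
  -- is 0.
  have hcosh : ∀ a, Real.cosh (s / (2 * R a) * R a) ≤ Real.exp c := by
    intro a
    rcases (hR a).eq_or_lt with h | h
    · rw [← h]
      simp [hc]
      positivity
    · refine (Real.cosh_le_exp_half_sq _).trans (Real.exp_le_exp.2 (le_of_eq ?_))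
      rw [hc]
      field_simp
      ring
  have he1 : ENNReal.ofReal (Real.exp (-c)) ≤ 1 := by
    rw [← ENNReal.ofReal_one]
    refine ENNReal.ofReal_le_ofReal (Real.exp_le_one_iff.2 ?_)
    rw [hc]
    have := sq_nonneg s
    linarith
  calc _ ≤ p.expect (fun xs => (assignAll k Q xs reps).expect fun res => ENNReal.ofReal K *
          (∑ a, ({P | selectedLabel P = some a}.indicator 1 (res.2.map (Prod.map lab id))
        * (ENNReal.ofReal (Real.exp (-(2 * c))) ^ labelCount lab a res.2 *
          ENNReal.ofReal (Real.cosh (s / (2 * R a) * ‖labelDeviation lab a (μ a) res.2‖)))) +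
        {P | selectedLabel P = none}.indicator 1 (res.2.map (Prod.map lab id)))) := by
        refine PMF.expect_mono fun xs hxs => PMF.expect_mono fun res hres => ?_
        refine indicator_not_isAccurate_le hk hs hR hK1 hK2
          (assignAll_isConsistent hQ (hxsX xs hxs) hreps hres) fun z hz => ?_
        exact hbd _ (hxsS xs hxs _ ((assignAll_support hQ (hxsX xs hxs) hreps hres).2.2 z hz).1)
    -- Averaging the positions for each selected label replaces e^{-2c} per found point, times the
    -- `cosh`, by e^{-c} per found point.
    _ ≤ ENNReal.ofReal K * p.expect (fun xs => (assignAll k Q xs reps).expect fun res =>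
          (∑ a, ({P | selectedLabel P = some a}.indicator 1 (res.2.map (Prod.map lab id))
            * ENNReal.ofReal (Real.exp (-c)) ^ labelCount lab a res.2) +
          {P | selectedLabel P = none}.indicator 1 (res.2.map (Prod.map lab id)))) := by
        simp only [PMF.expect_const_mul, PMF.expect_add, PMF.expect_finset_sum]
        gcongr with a
        exact expect_assignAll_cosh_le hS (hR a) (fun x hx hxa => hxa ▸ hbd x hx) (hsum a)
          (hcosh a) hQ hlab hSX hreps.mem n ({P | selectedLabel P = some a}.indicator 1)
    _ ≤ T := by
        rw [← PMF.expect_const_mul]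
        refine PMF.expect_le fun xs hxs => ?_
        -- For a fixed sample, a label `b` with at least a 1/k share of it replaces the selected
        -- one.
        obtain ⟨b, hb⟩ := exists_length_le_mul_countP hk lab xs
        refine le_trans ?_ (hT _ ((drawIID_support hxs).1 ▸ hb))
        gcongr
        refine le_trans (PMF.expect_mono fun res hres => ?_)
          (expect_exp_labelCount_le hQ hq0 hq1 (by positivity) b (hxsX xs hxs) hreps)
        exact selected_moment_le hk (assignAll_isConsistent hQ (hxsX xs hxs) hreps hres) he1 b

end Sampling

/-! ### The search phase -/

section Search

variable {E : Type}

/-- The pairwise condition says that `P` holds on an initial segment, whose length is then the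
count. -/
theorem List.getElem_iff_lt_countP {P : E → Prop} [DecidablePred P] {L : List E}
    (h : L.Pairwise fun x y => P y → P x) {i : ℕ} (hi : i < L.length) :
    P L[i] ↔ i < L.countP fun x => P x := by
  induction L generalizing i with
  | nil => simp at hi
  | cons x L ih =>
    obtain ⟨hx, hL⟩ := List.pairwise_cons.1 h
    by_cases hPx : P x
    · rw [List.countP_cons_of_pos (by simpa using hPx)]
      cases i with
      | zero => simpa using hPx
      | succ i => simpa using ih hL (by simpa using hi)
    · have h0 : L.countP (fun x => P x) = 0 := by
        rw [List.countP_eq_zero]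
        intro y hy hPy
        exact hPx (hx y hy (by simpa using hPy))
      rw [List.countP_cons_of_neg (by simpa using hPx), h0]
      cases i with
      | zero => simpa using hPx
      | succ i =>
        simp only [List.getElem_cons_succ, not_lt_zero, iff_false]
        exact fun hP => hPx (hx _ (List.getElem_mem _) hP)

/-- Binary search finds the position `T`, unless one of its tests is not sure. -/
theorem expect_binarySearch_le {test : E → PMF SignType} {L : List E} {T : ℕ} {e : ℝ≥0∞}
    (h0 : ∀ x ∈ L, test x 0 ≤ e)
    (h1 : ∀ i (hi : i < L.length), 1 ∈ (test L[i]).support → i < T)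
    (hm1 : ∀ i (hi : i < L.length), -1 ∈ (test L[i]).support → T ≤ i) (s : ℕ) {lo hi : ℕ}
    (hlo : lo ≤ T) (hhi : T ≤ hi) (hL : hi ≤ L.length) (hs : hi - lo < 2 ^ s) :
    (binarySearch test L lo hi).expect (({some T} : Set (Option ℕ))ᶜ.indicator 1) ≤ s * e := by
  induction s generalizing lo hi with
  | zero =>
    rw [binarySearch, dif_neg (by simp at hs; omega)]
    change (PMF.pure (some lo)).expect _ ≤ _
    have : lo = T := by
      simp at hs
      omega
    rw [PMF.expect_pure, this]
    simp
  | succ s ih =>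
    rw [pow_succ] at hs
    by_cases hlt : lo < hi
    -- Removing the midpoint from fewer than 2^(s+1) positions leaves fewer than 2^s on either side.
    · have hmid : (lo + hi - 1) / 2 < L.length := by omega
      rw [binarySearch, dif_pos hlt, List.getElem?_eq_getElem hmid]
      have hrhs : ((s + 1 : ℕ) : ℝ≥0∞) * e = e + s * e := by
        push_cast
        ring
      rw [hrhs]
      refine PMF.expect_bind_le_add (P := {0}ᶜ) (fun y => indicator_one_le_one _ _) ?_ ?_
      · rw [compl_compl, PMF.expect_indicator_singleton]
        exact h0 _ (List.getElem_mem _)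
      · intro a ha ha0
        cases a with
        | zero => exact absurd rfl ha0
        | pos =>
          have := h1 _ hmid ha
          exact ih (by omega) hhi hL (by omega)
        | neg =>
          have := hm1 _ hmid ha
          exact ih hlo this (by omega) (by omega)
    · rw [binarySearch, dif_neg hlt]
      change (PMF.pure (some lo)).expect _ ≤ _
      have : lo = T := by omega
      rw [PMF.expect_pure, this]
      simp

variable {k : ℕ} {q : ℝ} {X : Set E} {lab : E → Fin k} {Q : E → E → PMF SignType}

theorem searchStep_eq (Q : E → E → PMF SignType) (drawB : PMF (List E)) (x : E) :
    searchStep Q drawB x = drawB.bind fun B => (B.mapM fun y => Q y x).bind fun as =>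
      PMF.pure (if 1 ∈ as then 1 else if -1 ∈ as then -1 else 0) := rfl

/-- A step is unsure only if all β independent answers are. The bound holds for each list that may
be drawn, also with repetitions, so the drawing rule does not matter. -/
theorem searchStep_zero_le (hQ : IsLabelOracle q X lab Q) {drawB : PMF (List E)} {β : ℕ}
    (hB : ∀ B ∈ drawB.support, B.length = β ∧ ∀ y ∈ B, y ∈ X) {x : E} (hx : x ∈ X) :
    searchStep Q drawB x 0 ≤ ENNReal.ofReal (1 - q) ^ β := by
  rw [← PMF.expect_indicator_singleton, searchStep_eq]
  simp only [PMF.expect_bind, PMF.expect_pure]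
  refine PMF.expect_le fun B hBs => ?_
  obtain ⟨hlen, hmem⟩ := hB B hBs
  rw [← hlen]
  refine le_trans (PMF.expect_mono fun as _ => indicator_one_le_of_imp fun h => ?_)
    (expect_mapM_forall_zero_le fun y hy => hQ.notSure_le y (hmem y hy) x hx)
  intro a ha
  rw [Set.mem_singleton_iff] at h
  split_ifs at h with h1 h2
  rcases SignType.trichotomy a with rfl | rfl | rfl
  · exact absurd ha h2
  · rfl
  · exact absurd ha h1

theorem exists_of_mem_support_mapM {f : E → PMF SignType} {ys : List E} {as : List SignType}
    (h : as ∈ (ys.mapM f).support) {a : SignType} (ha : a ∈ as) : ∃ y ∈ ys, f y a ≠ 0 := by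
  obtain ⟨hlen, h⟩ := List.forall₂_iff_get.1 (forall₂_of_mem_support_mapM h)
  obtain ⟨i, hi, rfl⟩ := List.getElem_of_mem ha
  exact ⟨ys[i], List.getElem_mem _, h i (hlen ▸ hi) hi⟩

theorem label_of_searchStep_one (hQ : IsLabelOracle q X lab Q) {drawB : PMF (List E)} {a : Fin k}
    (hB : ∀ B ∈ drawB.support, ∀ y ∈ B, y ∈ X ∧ lab y = a) {x : E} (hx : x ∈ X)
    (h : 1 ∈ (searchStep Q drawB x).support) : lab x = a := by
  rw [searchStep_eq, PMF.mem_support_bind_iff] at h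
  obtain ⟨B, hBs, h⟩ := h
  rw [PMF.mem_support_bind_iff] at h
  obtain ⟨as, has, h⟩ := h
  rw [PMF.support_pure, Set.mem_singleton_iff] at h
  have h1 : 1 ∈ as := by
    by_contra h1
    rw [if_neg h1] at h
    split_ifs at h
  obtain ⟨y, hy, hne⟩ := exists_of_mem_support_mapM has h1
  by_contra hxa
  obtain ⟨hyX, hya⟩ := hB B hBs y hy
  exact hne (hQ.different y hyX x hx (by rw [hya]; exact Ne.symm hxa))

theorem label_of_searchStep_neg_one (hQ : IsLabelOracle q X lab Q) {drawB : PMF (List E)}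
    {a : Fin k} (hB : ∀ B ∈ drawB.support, ∀ y ∈ B, y ∈ X ∧ lab y = a) {x : E} (hx : x ∈ X)
    (h : -1 ∈ (searchStep Q drawB x).support) : lab x ≠ a := by
  rw [searchStep_eq, PMF.mem_support_bind_iff] at h
  obtain ⟨B, hBs, h⟩ := h
  rw [PMF.mem_support_bind_iff] at h
  obtain ⟨as, has, h⟩ := h
  rw [PMF.support_pure, Set.mem_singleton_iff] at h
  have h1 : -1 ∈ as := by
    by_contra h1
    rw [if_neg h1] at h
    split_ifs at h
  obtain ⟨y, hy, hne⟩ := exists_of_mem_support_mapM has h1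
  intro hxa
  obtain ⟨hyX, hya⟩ := hB B hBs y hy
  exact hne (hQ.same y hyX x hx (by rw [hya, hxa]))

end Search

/-! ### Sorting by distance and cutting at a radius -/

section Sorting

variable {m : ℕ}

theorem sortByDist_perm (c : EuclideanSpace ℝ (Fin m)) (S : Finset (EuclideanSpace ℝ (Fin m))) :
    (sortByDist c S).Perm S.toList :=
  List.perm_insertionSort _ _

theorem mem_sortByDist {c : EuclideanSpace ℝ (Fin m)} {S : Finset (EuclideanSpace ℝ (Fin m))}
    {x : EuclideanSpace ℝ (Fin m)} : x ∈ sortByDist c S ↔ x ∈ S := by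
  rw [(sortByDist_perm c S).mem_iff, Finset.mem_toList]

theorem length_sortByDist (c : EuclideanSpace ℝ (Fin m))
    (S : Finset (EuclideanSpace ℝ (Fin m))) : (sortByDist c S).length = S.card := by
  rw [(sortByDist_perm c S).length_eq, Finset.length_toList]

theorem sortByDist_pairwise (c : EuclideanSpace ℝ (Fin m))
    (S : Finset (EuclideanSpace ℝ (Fin m))) :
    (sortByDist c S).Pairwise fun x y => dist x c ≤ dist y c := by
  classical
  have : Std.Total fun x y : EuclideanSpace ℝ (Fin m) => dist x c ≤ dist y c :=
    ⟨fun _ _ => le_total _ _⟩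
  have : IsTrans (EuclideanSpace ℝ (Fin m)) fun x y => dist x c ≤ dist y c :=
    ⟨fun _ _ _ => le_trans⟩
  exact List.pairwise_insertionSort _ _

/-- Cutting at the first point outside a ball-like subset gives the subset. -/
theorem cutAt_countP {c : EuclideanSpace ℝ (Fin m)} {S : Finset (EuclideanSpace ℝ (Fin m))}
    {P : EuclideanSpace ℝ (Fin m) → Prop} [DecidablePred P]
    (hP : ∀ x ∈ S, ∀ y ∈ S, P x → ¬ P y → dist x c < dist y c) :
    cutAt c S (sortByDist c S) ((sortByDist c S).countP fun x => P x) = S.filter P := by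
  have hpw : (sortByDist c S).Pairwise fun x y => P y → P x := by
    refine (sortByDist_pairwise c S).imp_of_mem fun {x y} hx hy hxy hPy => ?_
    by_contra hPx
    exact (hP y (mem_sortByDist.1 hy) x (mem_sortByDist.1 hx) hPy hPx).not_ge hxy
  have hiff := fun {i : ℕ} (hi : i < (sortByDist c S).length) =>
    List.getElem_iff_lt_countP hpw hi
  set T := (sortByDist c S).countP fun x => P x with hT
  rw [cutAt]
  cases h : (sortByDist c S)[T]? with
  -- There is no position `T`, so all points satisfy `P`: the case of infinite radius.
  | none =>
    rw [List.getElem?_eq_none_iff] at h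
    refine (Finset.filter_true_of_mem fun x hx => ?_).symm
    obtain ⟨i, hi, rfl⟩ := List.getElem_of_mem (mem_sortByDist (c := c).2 hx)
    exact (hiff hi).2 (hi.trans_le h)
  | some y =>
    obtain ⟨hlt, rfl⟩ := List.getElem?_eq_some_iff.1 h
    have hy : ¬ P (sortByDist c S)[T] := by
      rw [hiff hlt]
      exact lt_irrefl _
    have hyS := mem_sortByDist.1 (List.getElem_mem hlt)
    ext x
    simp only [Finset.mem_filter, and_congr_right_iff]
    intro hx
    refine ⟨fun hlt' => ?_, fun hPx => hP x hx _ hyS hPx hy⟩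
    obtain ⟨j, hj, rfl⟩ := List.getElem_of_mem (mem_sortByDist (c := c).2 hx)
    rw [hiff hj]
    by_contra! hTj
    rcases hTj.eq_or_lt with rfl | hTj
    · exact lt_irrefl _ hlt'
    · exact hlt'.not_ge (List.pairwise_iff_getElem.1 (sortByDist_pairwise c S) T j hlt hj hTj)

end Sorting

/-! ### The algorithm -/

section Main

variable {m k : ℕ} {X : Finset (EuclideanSpace ℝ (Fin m))}
  {C : Fin k → Finset (EuclideanSpace ℝ (Fin m))}

/-- The labels of the points of a partition. -/
theorem IsCenterBased.exists_label (hk : 0 < k) (hC : IsCenterBased X C) :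
    ∃ lab : EuclideanSpace ℝ (Fin m) → Fin k, ∀ x i, x ∈ C i ↔ x ∈ X ∧ lab x = i := by
  classical
  refine ⟨fun x => if h : ∃ i, x ∈ C i then h.choose else ⟨0, hk⟩, fun x i => ?_⟩
  constructor
  · intro hx
    have h : ∃ i, x ∈ C i := ⟨i, hx⟩
    refine ⟨(hC.cover x).2 h, ?_⟩
    simp only [dif_pos h]
    by_contra hne
    exact Finset.disjoint_left.1 (hC.disjoint _ _ hne) h.choose_spec hx
  · rintro ⟨hx, rfl⟩
    have h := (hC.cover x).1 hx
    simp only [dif_pos h]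
    exact h.choose_spec

/-- As answers are never wrong, only 0 and the correct answer can have mass. The mass of 0 depends
on the clusters only, hence so does the whole law. -/
theorem IsRandomWeakOracle.isLabelOracle {q : ℝ}
    {Q : EuclideanSpace ℝ (Fin m) → EuclideanSpace ℝ (Fin m) → PMF SignType}
    (hQ : IsRandomWeakOracle q C Q) {lab : EuclideanSpace ℝ (Fin m) → Fin k}
    (hlab : ∀ x i, x ∈ C i ↔ x ∈ X ∧ lab x = i) : IsLabelOracle q (X : Set _) lab Q where
  same x hx y hy h := hQ.same (lab x) x ((hlab _ _).2 ⟨hx, rfl⟩) y ((hlab _ _).2 ⟨hy, h.symm⟩)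
  different x hx y hy h :=
    hQ.different _ _ h x ((hlab _ _).2 ⟨hx, rfl⟩) y ((hlab _ _).2 ⟨hy, rfl⟩)
  notSure_le x hx y hy :=
    hQ.notSure_le _ _ x ((hlab _ _).2 ⟨hx, rfl⟩) y ((hlab _ _).2 ⟨hy, rfl⟩)
  congr x hx x' hx' y hy y' hy' hxx hyy := by
    have mx := (hlab x (lab x)).2 ⟨hx, rfl⟩
    have mx' := (hlab x' (lab x)).2 ⟨hx', hxx.symm⟩
    have my := (hlab y (lab y)).2 ⟨hy, rfl⟩
    have my' := (hlab y' (lab y)).2 ⟨hy', hyy.symm⟩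
    have h0 := hQ.notSure_eq _ _ x mx x' mx' y my y' my'
    have hs := (Q x y).signType_sum
    rw [← (Q x' y').signType_sum, h0, add_assoc, add_assoc,
      ENNReal.add_right_inj ((Q x' y').apply_ne_top 0)] at hs
    refine PMF.ext fun a => ?_
    by_cases h : lab x = lab y
    · rw [← h] at my my'
      have e1 := hQ.same _ x mx y my
      have e2 := hQ.same _ x' mx' y' my'
      rw [e1, e2, zero_add, zero_add] at hs
      rcases SignType.trichotomy a with rfl | rfl | rfl
      · rw [e1, e2]
      · exact h0
      · exact hs
    · have e1 := hQ.different _ _ h x mx y my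
      have e2 := hQ.different _ _ h x' mx' y' my'
      rw [e1, e2, add_zero, add_zero] at hs
      rcases SignType.trichotomy a with rfl | rfl | rfl
      · exact hs
      · exact h0
      · rw [e1, e2]

/-! ### Geometry of clusters with margin -/

theorem sum_sub_clusterMean {A : Finset (EuclideanSpace ℝ (Fin m))} (hA : A.Nonempty) :
    ∑ x ∈ A, (x - clusterMean A) = 0 := by
  have : (A.card : ℝ) ≠ 0 := by
    have := hA.card_pos
    positivity
  rw [Finset.sum_sub_distrib, Finset.sum_const, clusterMean, ← Nat.cast_smul_eq_nsmul ℝ, smul_smul,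
    mul_inv_cancel₀ this, one_smul, sub_self]

/-- The radius of a cluster around its mean. -/
theorem exists_clusterRadius {A : Finset (EuclideanSpace ℝ (Fin m))} (hA : A.Nonempty) :
    ∃ R : ℝ, 0 ≤ R ∧ (∀ x ∈ A, dist x (clusterMean A) ≤ R) ∧
      ∃ x ∈ A, dist x (clusterMean A) = R := by
  obtain ⟨x, hx, hmax⟩ := A.exists_max_image (fun x => dist x (clusterMean A)) hA
  exact ⟨dist x (clusterMean A), dist_nonneg, hmax, x, hx, rfl⟩

/-- A point close to the center of a cluster separates the cluster from the other points. -/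
theorem HasMargin.dist_lt {γ : ℝ} (hmargin : HasMargin γ X C) {a : Fin k} {R : ℝ}
    (hR : ∀ x ∈ C a, dist x (clusterMean (C a)) ≤ R)
    (hR' : ∃ x ∈ C a, dist x (clusterMean (C a)) = R) {c : EuclideanSpace ℝ (Fin m)}
    (hc : dist c (clusterMean (C a)) ≤ (γ - 1) / 2 * R) {x y : EuclideanSpace ℝ (Fin m)}
    (hx : x ∈ C a) (hy : y ∈ X) (hya : y ∉ C a) : dist x c < dist y c := by
  obtain ⟨z, hz, rfl⟩ := hR'
  -- The margin is applied to a farthest point `z` of the cluster. The two triangle inequalities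
  -- then put (γ+1)/2 · R between the distances of x and y to `c`.
  have h1 := hmargin a z hz y hy hya
  have h2 := hR x hx
  have h3 := dist_triangle_right x c (clusterMean (C a))
  have h4 := dist_triangle y c (clusterMean (C a))
  linarith

/-- Sampling and assignment are grouped into one random choice, followed by the search, as the union
bound requires. -/
theorem ssacRound_eq {r : ℕ}
    {Q : EuclideanSpace ℝ (Fin m) → EuclideanSpace ℝ (Fin m) → PMF SignType}
    {draw : List (EuclideanSpace ℝ (Fin m)) → PMF (List (EuclideanSpace ℝ (Fin m)))}
    {S : Finset (EuclideanSpace ℝ (Fin m))} (hS : S.Nonempty)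
    (reps : List (EuclideanSpace ℝ (Fin m))) :
    ssacRound k r Q draw S reps =
      ((drawIID (PMF.uniformOfFinset S hS) r).bind fun xs => assignAll k Q xs reps).bind fun res =>
        match selectedIndex k res.2 with
        | none => PMF.pure none
        | some p => open Classical in if pointsWithIndex res.2 p = [] then PMF.pure none else
            let c := ((pointsWithIndex res.2 p).length : ℝ)⁻¹ • (pointsWithIndex res.2 p).sum
            (binarySearch (searchStep Q (draw (pointsWithIndex res.2 p))) (sortByDist c S) 0
              (sortByDist c S).length).bind fun j =>
                PMF.pure (j.map fun j => (cutAt c S (sortByDist c S) j, res.1)) := by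
  rw [ssacRound, dif_pos hS, PMF.bind_bind]
  rfl

variable {γ q : ℝ} {lab : EuclideanSpace ℝ (Fin m) → Fin k}
  {Q : EuclideanSpace ℝ (Fin m) → EuclideanSpace ℝ (Fin m) → PMF SignType}
  {draw : List (EuclideanSpace ℝ (Fin m)) → PMF (List (EuclideanSpace ℝ (Fin m)))} {β r : ℕ}
  {T e : ℝ≥0∞}

/-- A round finds one of the remaining clusters, except with small probability. -/
theorem expect_ssacRound_le (hk : 0 < k) (hγ : 1 < γ) (hq0 : 0 ≤ q) (hq1 : q ≤ 1)
    (hC : IsCenterBased X C) (hmargin : HasMargin γ X C)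
    (hlab : ∀ x i, x ∈ C i ↔ x ∈ X ∧ lab x = i) (hQ : IsLabelOracle q (X : Set _) lab Q)
    (hdraw : IsDrawRule β draw)
    (hT : ∀ N : ℕ, r ≤ k * N → ENNReal.ofReal (m + 1) *
      ENNReal.ofReal (1 - q ^ (k - 1) + q ^ (k - 1) * Real.exp (-((γ - 1) ^ 2 / 8))) ^ N ≤ T)
    (he : ENNReal.ofReal (1 - q) ^ β ≤ e) {S : Finset (EuclideanSpace ℝ (Fin m))}
    {I : Finset (Fin k)} (hI : I.Nonempty) (hSI : ∀ x, x ∈ S ↔ x ∈ X ∧ lab x ∈ I)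
    {reps : List (EuclideanSpace ℝ (Fin m))} (hreps : IsKnownList (X : Set _) lab reps) :
    (ssacRound k r Q draw S reps).expect
      ({o | ∃ i ∈ I, ∃ reps', o = some (C i, reps') ∧ IsKnownList (X : Set _) lab reps'}ᶜ.indicator
        1) ≤ T + (Nat.log 2 X.card + 1 : ℕ) * e := by
  have hSX : ∀ x ∈ S, x ∈ X := fun x hx => ((hSI x).1 hx).1
  have hfilter : ∀ a ∈ I, S.filter (fun x => lab x = a) = C a := by
    intro a ha
    ext x
    rw [Finset.mem_filter, hSI, hlab]
    constructor
    · rintro ⟨⟨h1, -⟩, h2⟩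
      exact ⟨h1, h2⟩
    · rintro ⟨h1, rfl⟩
      exact ⟨⟨h1, ha⟩, rfl⟩
  have hS : S.Nonempty := by
    obtain ⟨i, hi⟩ := hI
    obtain ⟨x, hx⟩ := hC.nonempty i
    obtain ⟨h1, rfl⟩ := (hlab x i).1 hx
    exact ⟨x, (hSI x).2 ⟨h1, hi⟩⟩
  choose R hR0 hR hR' using fun i => exists_clusterRadius (hC.nonempty i)
  have hsupp : ∀ {xs}, xs ∈ (drawIID (PMF.uniformOfFinset S hS) r).support → ∀ x ∈ xs, x ∈ S := by
    intro xs hxs x hx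
    have := (drawIID_support hxs).2 x hx
    rwa [PMF.mem_support_uniformOfFinset_iff] at this
  rw [ssacRound_eq hS]
  refine PMF.expect_bind_le_add
    (P := {res | IsAccurate k lab (fun a => clusterMean (C a)) (fun a => (γ - 1) / 2 * R a) res.2})
    (fun _ => indicator_one_le_one _ _) ?_ ?_
  · rw [PMF.expect_bind]
    refine expect_not_isAccurate_le hk hq0 hq1 (by linarith) hR0 (by simp) (fun a ha => ?_) hS
      (fun x hx => ?_) (fun a => ?_) hQ (fun i => ?_) hSX hreps hT
    -- A positive radius needs m ≥ 1, so that 2 ≤ m + 1.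
    · have hm : m ≠ 0 := by
        rintro rfl
        obtain ⟨x, -, hx⟩ := hR' a
        rw [← hx, Subsingleton.elim x (clusterMean (C a)), dist_self] at ha
        exact lt_irrefl _ ha
      have : (1 : ℝ) ≤ m := by exact_mod_cast Nat.one_le_iff_ne_zero.2 hm
      linarith
    · rw [← dist_eq_norm]
      exact hR _ x ((hlab _ _).2 ⟨hSX x hx, rfl⟩)
    -- Clusters are removed as a whole: what is left of a cluster is either all of it, centered at
    -- its mean, or empty.
    · by_cases ha : a ∈ I
      · rw [hfilter a ha]
        exact sum_sub_clusterMean (hC.nonempty a)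
      · rw [Finset.filter_false_of_mem, Finset.sum_empty]
        rintro x hx rfl
        exact ha ((hSI x).1 hx).2
    · obtain ⟨x, hx⟩ := hC.nonempty i
      exact ⟨x, ((hlab x i).1 hx).1, ((hlab x i).1 hx).2⟩
  · intro res hres hacc
    rw [PMF.mem_support_bind_iff] at hres
    obtain ⟨xs, hxs, hres⟩ := hres
    have hxsS := hsupp hxs
    obtain ⟨hknown, -, hfound⟩ :=
      assignAll_support hQ (fun x hx => hSX x (hxsS x hx)) hreps hres
    obtain ⟨p, hp⟩ := exists_selectedIndex hk res.2
    obtain ⟨hne, a, hall, hmean⟩ := hacc p hp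
    rw [← dist_eq_norm] at hmean
    set Zp := pointsWithIndex res.2 p with hZp
    set c := (Zp.length : ℝ)⁻¹ • Zp.sum with hc
    simp only [hp, ← hZp, if_neg hne, ← hc]
    have hZS : ∀ y ∈ Zp, y ∈ S := fun y hy =>
      hxsS y (hfound _ (mem_pointsWithIndex.1 hy)).1
    have haI : a ∈ I := by
      obtain ⟨y, hy⟩ := List.exists_mem_of_ne_nil _ hne
      rw [← hall y hy]
      exact ((hSI y).1 (hZS y hy)).2
    have hcut := cutAt_countP (c := c) (S := S) (P := fun x => lab x = a)
      fun x hx y hy hxa hya => hmargin.dist_lt (hR a) (hR' a) hmean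
        ((hlab x a).2 ⟨hSX x hx, hxa⟩) (hSX y hy) fun h => hya ((hlab y a).1 h).2
    rw [hfilter a haI] at hcut
    -- By the margin, the cluster is an initial segment of the sorted list.
    have hpw : (sortByDist c S).Pairwise fun x y => lab y = a → lab x = a := by
      refine (sortByDist_pairwise c S).imp_of_mem fun {x y} hx hy hxy hya => ?_
      by_contra hxa
      have hx := hSX x (mem_sortByDist.1 hx)
      have hy := hSX y (mem_sortByDist.1 hy)
      exact (hmargin.dist_lt (hR a) (hR' a) hmean ((hlab y a).2 ⟨hy, hya⟩) hx
        fun h => hxa ((hlab x a).1 h).2).not_ge hxy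
    have hLX : ∀ i (hi : i < (sortByDist c S).length), (sortByDist c S)[i] ∈ (X : Set _) :=
      fun i hi => hSX _ (mem_sortByDist.1 (List.getElem_mem hi))
    have hB : ∀ B ∈ (draw Zp).support, ∀ y ∈ B, y ∈ (X : Set _) ∧ lab y = a := by
      intro B hB y hy
      have hyZ := (hdraw Zp hne B hB).2 y hy
      exact ⟨hSX y (hZS y hyZ), hall y hyZ⟩
    have hsearch := expect_binarySearch_le (test := searchStep Q (draw Zp)) (L := sortByDist c S)
      (T := (sortByDist c S).countP fun x => lab x = a) (e := e)
      (fun x hx => (searchStep_zero_le hQ (fun B hBs => ⟨(hdraw Zp hne B hBs).1,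
        fun y hy => (hB B hBs y hy).1⟩) (hSX x (mem_sortByDist.1 hx))).trans he)
      (fun i hi h => (List.getElem_iff_lt_countP hpw hi).1
        (label_of_searchStep_one hQ hB (hLX i hi) h))
      (fun i hi h => not_lt.1 fun hlt => label_of_searchStep_neg_one hQ hB (hLX i hi) h
        ((List.getElem_iff_lt_countP hpw hi).2 hlt))
      -- The number of steps, from |S| ≤ n < 2^(⌊log₂ n⌋+1).
      (Nat.log 2 X.card + 1) (Nat.zero_le _) List.countP_le_length le_rfl (by
        rw [length_sortByDist, Nat.sub_zero]
        exact (Finset.card_le_card hSX).trans_lt (Nat.lt_pow_succ_log_self (by norm_num) _))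
    refine le_trans ?_ hsearch
    simp only [PMF.expect_bind, PMF.expect_pure]
    refine PMF.expect_mono fun j _ => indicator_one_le_of_imp fun hj hjT => hj ?_
    rw [Set.mem_singleton_iff] at hjT
    subst hjT
    exact ⟨a, haI, res.1, by rw [Option.map_some, hcut], hknown⟩

theorem ssacLoop_succ (n : ℕ) (S : Finset (EuclideanSpace ℝ (Fin m)))
    (reps : List (EuclideanSpace ℝ (Fin m))) (found : Finset (Finset (EuclideanSpace ℝ (Fin m)))) :
    ssacLoop k r Q draw (n + 1) S reps found = (ssacRound k r Q draw S reps).bind fun res =>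
      match res with
      | none => PMF.pure none
      | some (A, reps') =>
        open Classical in ssacLoop k r Q draw n (S \ A) reps' (insert A found) := rfl

/-- The rounds find all the clusters if each of them finds one of the remaining clusters. -/
theorem expect_ssacLoop_le {t : ℝ≥0∞} (hlab : ∀ x i, x ∈ C i ↔ x ∈ X ∧ lab x = i)
    (hround : ∀ (S : Finset (EuclideanSpace ℝ (Fin m))) (I : Finset (Fin k))
      (reps : List (EuclideanSpace ℝ (Fin m))), I.Nonempty →
      (∀ x, x ∈ S ↔ x ∈ X ∧ lab x ∈ I) → IsKnownList (X : Set _) lab reps →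
      (ssacRound k r Q draw S reps).expect ({o | ∃ i ∈ I, ∃ reps', o = some (C i, reps') ∧
        IsKnownList (X : Set _) lab reps'}ᶜ.indicator 1) ≤ t)
    (n : ℕ) {S : Finset (EuclideanSpace ℝ (Fin m))} {I : Finset (Fin k)} (hn : I.card = n)
    (hSI : ∀ x, x ∈ S ↔ x ∈ X ∧ lab x ∈ I) {reps : List (EuclideanSpace ℝ (Fin m))}
    (hreps : IsKnownList (X : Set _) lab reps)
    {found : Finset (Finset (EuclideanSpace ℝ (Fin m)))}
    (hfound : ∀ A, A ∈ found ↔ ∃ i ∉ I, C i = A) :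
    (ssacLoop k r Q draw n S reps found).expect (({some (clusterSet C)} : Set _)ᶜ.indicator 1) ≤ n * t := by
  induction n generalizing S I reps found with
  | zero =>
    rw [Finset.card_eq_zero] at hn
    subst hn
    change (PMF.pure (some found)).expect _ ≤ _
    have : found = clusterSet C := by
      ext A
      simp [hfound, clusterSet]
    rw [PMF.expect_pure, this]
    simp
  | succ n ih =>
    have hI : I.Nonempty := Finset.card_pos.1 (by omega)
    have hrhs : ((n + 1 : ℕ) : ℝ≥0∞) * t = t + n * t := by
      push_cast
      ring
    rw [hrhs, ssacLoop_succ]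
    refine PMF.expect_bind_le_add (fun _ => indicator_one_le_one _ _)
      (hround S I reps hI hSI hreps) ?_
    rintro _ - ⟨i, hi, reps', rfl, hreps'⟩
    -- `S` stays the union of the clusters with index in `I`, and `found` consists of the others.
    refine ih (I := I.erase i) (by rw [Finset.card_erase_of_mem hi, hn]; rfl) (fun x => ?_) hreps'
      (fun A => ?_)
    · rw [Finset.mem_sdiff, hSI, hlab, Finset.mem_erase]
      tauto
    · rw [Finset.mem_insert, hfound]
      constructor
      · rintro (rfl | ⟨j, hj, rfl⟩)
        · exact ⟨i, by simp, rfl⟩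
        · exact ⟨j, fun h => hj (Finset.mem_of_mem_erase h), rfl⟩
      · rintro ⟨j, hj, rfl⟩
        by_cases hji : j = i
        · exact Or.inl (by rw [hji])
        · exact Or.inr ⟨j, fun h => hj (Finset.mem_erase.2 ⟨hji, h⟩), rfl⟩

theorem mul_pow_le_one_of_log_div_le {A ρ : ℝ} (hA : 0 < A) (hρ0 : 0 < ρ) (hρ1 : ρ < 1) {N : ℕ}
    (h : Real.log A / Real.log (1 / ρ) ≤ N) : A * ρ ^ N ≤ 1 := by
  have hlog : 0 < Real.log (1 / ρ) := Real.log_pos (one_lt_one_div hρ0 hρ1)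
  rw [div_le_iff₀ hlog, one_div, Real.log_inv] at h
  have h2 : Real.log (A * ρ ^ N) ≤ 0 := by
    rw [Real.log_mul hA.ne' (by positivity), Real.log_pow]
    linarith
  exact (Real.log_nonpos_iff (by positivity)).1 h2

end Main

theorem theorem1 {m k : ℕ} (hk : 1 ≤ k)
    (X : Finset (EuclideanSpace ℝ (Fin m)))
    (C : Fin k → Finset (EuclideanSpace ℝ (Fin m)))
    (γ δ q : ℝ) (hγ : 1 < γ) (hδ : 0 < δ ∧ δ < 1) (hq : 0 < q ∧ q ≤ 1)
    (hC : IsCenterBased X C) (hmargin : HasMargin γ X C)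
    (Q : EuclideanSpace ℝ (Fin m) → EuclideanSpace ℝ (Fin m) → PMF SignType)
    (hQ : IsRandomWeakOracle q C Q)
    (η : ℝ) (hη : etaBound m k q γ δ ≤ η)
    (β : ℕ) (hβ1 : 1 ≤ β) (hβ : betaBound X.card k q δ ≤ (β : ℝ))
    (draw : List (EuclideanSpace ℝ (Fin m)) → PMF (List (EuclideanSpace ℝ (Fin m))))
    (hdraw : IsDrawRule β draw) :
    ENNReal.ofReal (1 - δ) ≤ ssac k η Q draw X (some (clusterSet C)) := by
  obtain ⟨hδ0, hδ1⟩ := hδ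
  obtain ⟨hq0, hq1⟩ := hq
  have hk0 : (0 : ℝ) < k := by exact_mod_cast hk
  obtain ⟨lab, hlab⟩ := hC.exists_label hk
  have hQ' := hQ.isLabelOracle hlab
  have hT : ∀ N : ℕ, ⌈(k : ℝ) * η⌉₊ ≤ k * N → ENNReal.ofReal (m + 1) *
      ENNReal.ofReal (1 - q ^ (k - 1) + q ^ (k - 1) * Real.exp (-((γ - 1) ^ 2 / 8))) ^ N ≤
      ENNReal.ofReal (δ / (2 * k)) := by
    intro N hN
    -- A cluster with at least a 1/k share of the ⌈kη⌉ sample points has at least η of them.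
    have hηN : η ≤ N := by
      have h1 : (k : ℝ) * η ≤ k * N := (Nat.le_ceil _).trans (by exact_mod_cast hN)
      exact le_of_mul_le_mul_left h1 hk0
    have hpow0 : 0 < q ^ (k - 1) := pow_pos hq0 _
    have hpow1 : q ^ (k - 1) ≤ 1 := pow_le_one₀ hq0.le hq1
    have hexp1 : Real.exp (-((γ - 1) ^ 2 / 8)) < 1 := by
      rw [Real.exp_lt_one_iff]
      have : 0 < (γ - 1) ^ 2 := by
        have : γ - 1 ≠ 0 := by linarith
        positivity
      linarith
    have hexp0 := Real.exp_pos (-((γ - 1) ^ 2 / 8))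
    have hbound := hη.trans hηN
    rw [etaBound, neg_div] at hbound
    have hρ0 : 0 < 1 - q ^ (k - 1) + q ^ (k - 1) * Real.exp (-((γ - 1) ^ 2 / 8)) := by
      have := mul_pos hpow0 hexp0
      linarith
    have h := mul_pow_le_one_of_log_div_le (by positivity) hρ0 (by nlinarith) hbound
    rw [← ENNReal.ofReal_pow hρ0.le, ← ENNReal.ofReal_mul (by positivity)]
    refine ENNReal.ofReal_le_ofReal ?_
    rw [le_div_iff₀ (by positivity)]
    rw [div_mul_eq_mul_div, div_le_one hδ0] at h
    linarith
  have he : ENNReal.ofReal (1 - q) ^ β ≤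
      ENNReal.ofReal (δ / (2 * k * ((Nat.log 2 X.card : ℝ) + 1))) := by
    -- For q = 1 no answer is unsure; β ≥ 1 is needed for 0^β = 0.
    by_cases hq' : q = 1
    · rw [hq', sub_self, ENNReal.ofReal_zero, zero_pow (by omega)]
      exact zero_le
    · rw [betaBound, if_neg hq'] at hβ
      have hq1' : q < 1 := lt_of_le_of_ne hq1 hq'
      have h := mul_pow_le_one_of_log_div_le (by positivity) (by linarith) (by linarith) hβ
      rw [← ENNReal.ofReal_pow (by linarith)]
      refine ENNReal.ofReal_le_ofReal ?_
      rw [le_div_iff₀ (by positivity)]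
      rw [div_mul_eq_mul_div, div_le_one hδ0] at h
      linarith
  have hloop := expect_ssacLoop_le hlab (fun S I reps hI hSI hreps =>
      expect_ssacRound_le hk hγ hq0.le hq1 hC hmargin hlab hQ' hdraw hT he hI hSI hreps)
    k (S := X) (I := Finset.univ) (by simp) (by simp) (reps := []) ⟨by simp, by simp⟩
    (found := ∅) (by simp)
  -- Per round, δ/(2k) for the sample and ⌊log₂ n⌋ + 1 equal shares of another δ/(2k) for the
  -- search.
  have htotal : (k : ℝ≥0∞) * (ENNReal.ofReal (δ / (2 * k)) + (Nat.log 2 X.card + 1 : ℕ) *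
      ENNReal.ofReal (δ / (2 * k * ((Nat.log 2 X.card : ℝ) + 1)))) = ENNReal.ofReal δ := by
    rw [← ENNReal.ofReal_natCast, ← ENNReal.ofReal_natCast, ← ENNReal.ofReal_mul (by positivity),
      ← ENNReal.ofReal_add (by positivity) (by positivity), ← ENNReal.ofReal_mul (by positivity)]
    congr 1
    push_cast
    field_simp
    ring
  rw [htotal] at hloop
  have hone := (ssac k η Q draw X).expect_indicator_compl_add {some (clusterSet C)}
  rw [PMF.expect_indicator_singleton] at hone
  rw [ENNReal.ofReal_sub _ hδ0.le, ENNReal.ofReal_one, tsub_le_iff_left, ← hone]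
  gcongr
  exact hloop
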